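/- **Setting.** Let $T\in(0,\infty)$, $H\in(1/2,1)$, $\mathcal T=[0,T]$. Let $P$ be a Borel probability measure on $C([0,T])$ (sup norm) under which the coordinate process $B(t)(\omega)=\omega(t)$ is a fractional Brownian motion of Hurst parameter $H$ (centred Gaussian with $\mathbb E[B(t)B(s)]=\frac12(t^{2H}+s^{2H}-|t-s|^{2H})$). Let $\Omega$ be the set of $\omega\in C([0,T])$ that are Hölder continuous of every exponent $\beta\in(0,H)$. For $\omega\in\Omega$ the pathwise integral $\int_0^t f(s)\,\delta B(s)$ is the limit of the sums $\sum_k f(s_k)(\omega(s_{k+1})-\omega(s_k))$ over partitions $0=s_0<\dots<s_n=t$ as the mesh tends to $0$; if $f$ depends on $\omega$, the integral is taken at the same $\omega$. Let $\mathcal H$ be a Banach space continuously embedded in $C([0,T])$. A function $\Phi:\Omega\to\mathbb R$ is $\mathcal H$-differentiable if for each $\omega\in\Omega$ there is a bounded linear $\mathbb D\Phi(\omega):\mathcal H\to\mathbb R$ with $\frac{\Phi(\omega+\varepsilon k)-\Phi(\omega)}{\varepsilon}\to\mathbb D\Phi(\omega)k$ as $\varepsilon\to0$ for all $k\in\mathcal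 H\cap\Omega$. A function $\Phi(t,x,\omega)$ is continuously $\mathcal H$-differentiable if, in addition, for each $\omega\in\Omega$ the map $(t,x,k,k')\mapsto\mathbb D\Phi(t,x,\omega+k)k'$ is jointly continuous on $\mathcal T\times\mathbb R\times(\mathcal H\cap\Omega)\times\mathcal H$ ($k,k'$ in the norm of $\mathcal H$). **Data.** Let $h(t,u,\omega)$ be jointly continuous in $(t,u)\in\mathcal T^2$ for each $\omega\in\Omega$, and let $$\Gamma(t,\omega)=\omega+\int_0^{\cdot}h(t,u,\omega)\,du ,\qquad \Gamma(0,\omega)=\omega .$$ Assume that $t\mapsto\Gamma(t,\omega)$ is continuously differentiable with respect to the topology of $\mathcal H$: $\Gamma(t,\omega)-\omega$ lies in $\mathcal H$ and is a $C^1$ curve in $\mathcal H$, with derivative $\frac{d}{dt}\Gamma(t,\omega)\in\mathcal H$. Let $\eta(x,\omega)$, $\xi(\omega)$, $f_0(s,x,\omega)$, $f_1(s,x,\omega)$, $g_0(s,\omega)$, $g_1(s,\omega)$ be measurable and real-valued. Assume that for every $\omega\in\Omega$: - $f_0(s,x,\Gamma(r,\omega))$ is jointly continuous in $(s,x,r)\in\mathcal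 T\times\mathbb R\times\mathcal T$, and $g_0(s,\omega)$ is continuous in $s$; - $g_1(s,\omega)$ is Hölder continuous in $s$ of order greater than $1-H$; - $f_1(s,x,\Gamma(r,\omega))$ is Hölder continuous in $s$ and in $r$ of order greater than $1-H$ and Lipschitz in $x$, with order not depending on $(x,r,s)$ and constants uniform in $r,s\in\mathcal T$ and in $x$ from bounded sets. Define $$F(t,x,\omega)=\eta(x,\omega)+\int_0^t f_0(s,x,\omega)\,ds+\int_0^t f_1(s,x,\omega)\,\delta B(s),$$ $$G(t,\omega)=\xi(\omega)+\int_0^t g_0(s,\omega)\,ds+\int_0^t g_1(s,\omega)\,\delta B(s).$$ Assume that $F$ is differentiable in $x$ on $\mathcal T\times\mathbb R\times\Omega$; that for every $\omega\in\Omega$ both $F$ and $\frac{\partial F}{\partial x}$, evaluated at $(t,x,\Gamma(r,\omega))$, are Hölder continuous in $t$ of order greater than $1-H$ and Lipschitz in $x$, with order not depending on $(t,x,r)$ and constants uniform in $r\in\mathcal T$ and in $x$ from bounded sets; and that $F$ and $\frac{\partial F}{\partial x}$ are continuously $\mathcal H$-differentiable. **Theorem.** $P(\Omega)=1$, and for all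 $\omega\in\Omega$ and $t\in[0,T]$, all the integrals below exist and, writing $G(s)=G(s,\omega)$, $\Gamma(s)=\Gamma(s,\omega)$, $$\begin{aligned}F(t,G(t),\Gamma(t))={}&\eta(\xi(\omega),\omega)+\int_0^t f_0(s,G(s),\Gamma(s))\,ds+\int_0^t f_1(s,G(s),\Gamma(s))\,\delta B(s)\\&+\int_0^t f_1(s,G(s),\Gamma(s))\,h(s,s,\omega)\,ds+\int_0^t\frac{\partial F}{\partial x}(s,G(s),\Gamma(s))\,g_0(s,\omega)\,ds\\&+\int_0^t\frac{\partial F}{\partial x}(s,G(s),\Gamma(s))\,g_1(s,\omega)\,\delta B(s)+\int_0^t(\mathbb DF)(s,G(s),\Gamma(s))\,\frac{d}{ds}\Gamma(s)\,ds .\end{aligned}$$ -/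

import Mathlib

open MeasureTheory Filter Topology

noncomputable section

/-- The path space `C([0, T])` of continuous real functions on `[0, T]`, with the sup norm. -/
abbrev PathSpace (T : ℝ) : Type := C(Set.Icc (0 : ℝ) T, ℝ)

namespace PathSpace

/-- The coordinate process `B(s)(ω) = ω(s)`, `0 ≤ s ≤ T` (and `0` for `s` outside `[0, T]`). -/
def coord {T : ℝ} (ω : PathSpace T) (s : ℝ) : ℝ :=
  open Classical in if hs : s ∈ Set.Icc (0 : ℝ) T then ω ⟨s, hs⟩ else 0

/-- Paths that are Hölder continuous of every exponent `β < H`. -/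
def holderPaths (T H : ℝ) : Set (PathSpace T) :=
  {ω | ∀ β : ℝ, 0 < β → β < H → ∃ C : ℝ, ∀ s t : Set.Icc (0 : ℝ) T,
    |ω s - ω t| ≤ C * |(s : ℝ) - (t : ℝ)| ^ β}

/-- Under the probability measure `P`, the coordinate process is a fractional Brownian motion of
Hurst parameter `H`: a centred Gaussian process with covariance
`(t ^ (2 H) + s ^ (2 H) - |t - s| ^ (2 H)) / 2`. -/
structure IsFBMLaw {T : ℝ} [MeasurableSpace (PathSpace T)] (H : ℝ)
    (P : Measure (PathSpace T)) : Prop where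
  isProbability : IsProbabilityMeasure P
  gaussian : ProbabilityTheory.IsGaussianProcess
    (fun (t : Set.Icc (0 : ℝ) T) (ω : PathSpace T) => ω t) P
  centered : ∀ t : Set.Icc (0 : ℝ) T, ∫ ω : PathSpace T, ω t ∂P = 0
  covariance : ∀ s t : Set.Icc (0 : ℝ) T, ∫ ω : PathSpace T, ω t * ω s ∂P =
    ((t : ℝ) ^ (2 * H) + (s : ℝ) ^ (2 * H) - |(t : ℝ) - (s : ℝ)| ^ (2 * H)) / 2

/-- `I` is the pathwise integral `∫₀ᵗ f(s) δB(s)` at the path `ω`: the limit of the Riemann sums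
`∑ f(sₖ) (B(sₖ₊₁) - B(sₖ))` over partitions `0 = s₀ < s₁ < ⋯ < sₙ = t` as the mesh tends to `0`. -/
def HasPathwiseIntegral {T : ℝ} (f : ℝ → ℝ) (ω : PathSpace T) (t I : ℝ) : Prop :=
  ∀ ε > 0, ∃ δ > 0, ∀ (n : ℕ) (p : ℕ → ℝ), p 0 = 0 → p n = t →
    (∀ i < n, p i < p (i + 1) ∧ p (i + 1) - p i < δ) →
    |∑ i ∈ Finset.range n, f (p i) * (coord ω (p (i + 1)) - coord ω (p i)) - I| < ε

/-- The pathwise integral `∫₀ᵗ f(s) δB(s)` exists at the path `ω`. -/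
def PathwiseIntegrable {T : ℝ} (f : ℝ → ℝ) (ω : PathSpace T) (t : ℝ) : Prop :=
  ∃ I : ℝ, HasPathwiseIntegral f ω t I

/-- The value of the pathwise integral `∫₀ᵗ f(s) δB(s)` at the path `ω` (`0` if it does not
exist). -/
def pathwiseIntegral {T : ℝ} (f : ℝ → ℝ) (ω : PathSpace T) (t : ℝ) : ℝ :=
  open Classical in if hI : PathwiseIntegrable f ω t then hI.choose else 0

/-- `F(t, x, ω) = η(x, ω) + ∫₀ᵗ f₀(s, x, ω) ds + ∫₀ᵗ f₁(s, x, ω) δB(s)`. -/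
def fieldF {T : ℝ} (η : ℝ → PathSpace T → ℝ) (f₀ f₁ : ℝ → ℝ → PathSpace T → ℝ)
    (t x : ℝ) (ω : PathSpace T) : ℝ :=
  η x ω + (∫ s in (0 : ℝ)..t, f₀ s x ω) + pathwiseIntegral (fun s => f₁ s x ω) ω t

/-- The partial derivative `∂F/∂x (t, x, ω)`. -/
def partialX {T : ℝ} (F : ℝ → ℝ → PathSpace T → ℝ) (t x : ℝ) (ω : PathSpace T) : ℝ :=
  deriv (fun y => F t y ω) x

/-- `G(t, ω) = ξ(ω) + ∫₀ᵗ g₀(s, ω) ds + ∫₀ᵗ g₁(s, ω) δB(s)`. -/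
def processG {T : ℝ} (ξ : PathSpace T → ℝ) (g₀ g₁ : ℝ → PathSpace T → ℝ)
    (t : ℝ) (ω : PathSpace T) : ℝ :=
  ξ ω + (∫ s in (0 : ℝ)..t, g₀ s ω) + pathwiseIntegral (fun s => g₁ s ω) ω t

/-- The path `s ↦ ∫₀ˢ v(u) du` (`0` if this is not a continuous function on `[0, T]`). -/
def primitivePath (T : ℝ) (v : ℝ → ℝ) : PathSpace T :=
  open Classical in
  if hv : Continuous (fun s : Set.Icc (0 : ℝ) T => ∫ u in (0 : ℝ)..(s : ℝ), v u) then ⟨_, hv⟩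
  else 0

theorem primitivePath_apply {T : ℝ} {v : ℝ → ℝ} (hv : ContinuousOn v (Set.Icc 0 T))
    (s : Set.Icc (0 : ℝ) T) : primitivePath T v s = ∫ u in (0 : ℝ)..(s : ℝ), v u := by
  have hT : (0 : ℝ) ≤ T := s.2.1.trans s.2.2
  have hi : IntegrableOn v (Set.uIcc 0 T) volume := by
    rw [Set.uIcc_of_le hT]
    exact hv.integrableOn_Icc
  have ho := intervalIntegral.continuousOn_primitive_interval hi
  rw [Set.uIcc_of_le hT] at ho
  have hc : Continuous (fun s : Set.Icc (0 : ℝ) T => ∫ u in (0 : ℝ)..(s : ℝ), v u) :=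
    ho.comp_continuous continuous_subtype_val (fun s => s.2)
  simp [primitivePath, hc]

/-- `Γ(t, ω) = ω + ∫₀^· h(t, u, ω) du`. -/
def transform {T : ℝ} (h : ℝ → ℝ → PathSpace T → ℝ) (t : ℝ) (ω : PathSpace T) : PathSpace T :=
  ω + primitivePath T (fun u => h t u ω)

section Differentiability

variable {T : ℝ} {E : Type*} [NormedAddCommGroup E] [NormedSpace ℝ E]

/-- A functional `Φ` defined on the set of paths that are Hölder of every exponent `< H` is
differentiable at `ω` along the space `E`, embedded in the path space by `j`, with derivative `L`:
`(Φ(ω + ε k) - Φ(ω)) / ε → L k` as `ε → 0`, for each direction `k ∈ E` that keeps the path in the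
domain of `Φ`. -/
def HasDirDeriv (H : ℝ) (j : E →L[ℝ] PathSpace T) (Φ : PathSpace T → ℝ) (L : E →L[ℝ] ℝ)
    (ω : PathSpace T) : Prop :=
  ∀ k : E, j k ∈ holderPaths T H →
    Tendsto (fun ε : ℝ => (Φ (ω + ε • j k) - Φ ω) / ε) (𝓝[≠] 0) (𝓝 (L k))

/-- `Φ(t, x, ω)` is continuously differentiable in `ω` along `E`, with derivative `D`: besides
having the derivative `D t x ω`, the map `(t, x, k, k') ↦ D(t, x, ω + k) k'` is jointly continuous,
`k` and `k'` being taken in the norm of `E`. -/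
def IsC1AlongE (H : ℝ) (j : E →L[ℝ] PathSpace T) (Φ : ℝ → ℝ → PathSpace T → ℝ)
    (D : ℝ → ℝ → PathSpace T → (E →L[ℝ] ℝ)) : Prop :=
  ∀ ω ∈ holderPaths T H,
    (∀ t ∈ Set.Icc (0 : ℝ) T, ∀ x : ℝ, HasDirDeriv H j (Φ t x) (D t x ω) ω) ∧
    ContinuousOn (fun p : ℝ × ℝ × E × E => D p.1 p.2.1 (ω + j p.2.2.1) p.2.2.2)
      {p | p.1 ∈ Set.Icc (0 : ℝ) T ∧ j p.2.2.1 ∈ holderPaths T H}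

/-- The curve `γ : [0, T] → C([0, T])` is continuously differentiable with respect to the topology
of `E`, with derivative `γ'`: the increments `γ(t) - γ(0)` lie in `E` and form a `C¹` curve
in `E`. -/
def IsC1CurveInE (j : E →L[ℝ] PathSpace T) (γ : ℝ → PathSpace T) (γ' : ℝ → E) : Prop :=
  ∃ κ : ℝ → E, (∀ t ∈ Set.Icc (0 : ℝ) T, γ t = γ 0 + j (κ t)) ∧
    (∀ t ∈ Set.Icc (0 : ℝ) T, HasDerivWithinAt κ (γ' t) (Set.Icc 0 T) t) ∧
    ContinuousOn γ' (Set.Icc 0 T)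

end Differentiability

/-- `Φ(t, x, ω')` is Hölder in `t` of an order greater than `a` and Lipschitz in `x`, uniformly for
`x` in bounded sets and for `ω'` on the curve `γ(r)`, `0 ≤ r ≤ T`. -/
def IsHolderLipAlong {T : ℝ} (a : ℝ) (γ : ℝ → PathSpace T)
    (Φ : ℝ → ℝ → PathSpace T → ℝ) : Prop :=
  ∃ μ > a, ∀ R : ℝ, ∃ C : ℝ, ∀ r ∈ Set.Icc (0 : ℝ) T,
    ∀ s ∈ Set.Icc (0 : ℝ) T, ∀ t ∈ Set.Icc (0 : ℝ) T, ∀ x y : ℝ, |x| ≤ R → |y| ≤ R →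
      |Φ s x (γ r) - Φ t y (γ r)| ≤ C * (|s - t| ^ μ + |x - y|)

/-- `Φ(t, x, γ(r))` is moreover Hölder in `r` of an order greater than `a`. -/
def IsHolderLipJointlyAlong {T : ℝ} (a : ℝ) (γ : ℝ → PathSpace T)
    (Φ : ℝ → ℝ → PathSpace T → ℝ) : Prop :=
  ∃ μ > a, ∀ R : ℝ, ∃ C : ℝ, ∀ q ∈ Set.Icc (0 : ℝ) T, ∀ r ∈ Set.Icc (0 : ℝ) T,
    ∀ s ∈ Set.Icc (0 : ℝ) T, ∀ t ∈ Set.Icc (0 : ℝ) T, ∀ x y : ℝ, |x| ≤ R → |y| ≤ R →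
      |Φ s x (γ q) - Φ t y (γ r)| ≤ C * (|s - t| ^ μ + |x - y| + |q - r| ^ μ)

end PathSpace

end

/-!
Everything except `P(Ω) = 1` is deterministic: fix a path `ω` which is `β`-Hölder for all `β < H`.
The formula follows from a uniform first-order expansion of `φ(s) = F(s, G(s), Γ(s))`,
`φ(t) - φ(s) = A(s) (t - s) + b(s) (ω(t) - ω(s)) + o(t - s)`, with `A` continuous and `b` Hölder of
an order `α > 1 - H`. Indeed the indefinite integrals of `A` (Lebesgue) and of `b` (Young) have the
same expansion, so that the difference `D` of the two sides has increments `o(t - s)` uniformly,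
and such a `D` is constant (`Negligible.eq_zero_of_increment`).

* Young integrals: `exists_young_integral` is the sewing lemma for the germ
  `f(s) (w(t) - w(s))`, resting on the partition-independent bound `abs_sum_sub_germ_le`. It gives
  an additive `J` with `J(t) - J(s) = f(s) (w(t) - w(s)) + O((t - s) ^ (α + β))`, `α + β > 1`, and
  `hasPathwiseIntegral_of_negligible` identifies `J` with the limit of Riemann sums.
* The expansion of `φ` moves the three arguments in turn. In `t`
  (`negligible_fieldF_time`), `F(·, x, Γ(s))` is a sum of integrals, one of them against the path
  `Γ(s) = ω + ∫ h(s, u) du`, which produces the term `f₁ h`. In `x`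
  (`negligible_space_increment`), the first-order Taylor expansion is enough: `∂F/∂x` is Hölder in
  `t` of order `α` and Lipschitz in `x`, and `G` is `β`-Hölder with `α + β > 1` and `2 β > 1`, so
  there is no second-order term. In `Γ` (`negligible_curve_increment`), the mean value theorem along
  segments in `E`, together with the joint continuity of `DF` near the compact curve, gives
  `DF(s, G(s), Γ(s)) Γ'(s) (t - s)`. The same lemma applied to `∂F/∂x` makes the integrand
  `∂F/∂x g₁` Hölder (`exists_holderBound_along_curve`).
* `P(Ω) = 1` is Kolmogorov's continuity argument: the increments have Gaussian moments
  `c |t - s| ^ (m H)` of every order `m` (`IsFBMLaw.lintegral_increment`), a weighted sum of the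
  `m`-th powers of all dyadic increments is integrable, and a continuous path with dyadic increments
  `O(2 ^ (-n β))` is `β`-Hölder (`holder_of_dyadic`).
-/

namespace PathSpace

theorem rpow_le_mul_rpow {d T α μ : ℝ} (hd : 0 ≤ d) (hdT : d ≤ T) (hα : 0 < α) (h : α ≤ μ) :
    d ^ μ ≤ T ^ (μ - α) * d ^ α := by
  calc d ^ μ = d ^ (μ - α) * d ^ α := by
        rw [← Real.rpow_add_of_nonneg hd (sub_nonneg.2 h) hα.le, sub_add_cancel]
    _ ≤ T ^ (μ - α) * d ^ α := by
        gcongr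

/-! ### Uniformly negligible increments -/

/-- The error term `A(s, t)` is `o(t - s)` as `t - s → 0`, uniformly over `0 ≤ s ≤ t ≤ T`. -/
def Negligible (T : ℝ) (A : ℝ → ℝ → ℝ) : Prop :=
  ∀ ε > 0, ∃ δ > 0, ∀ s t, 0 ≤ s → s ≤ t → t ≤ T → t - s < δ → |A s t| ≤ ε * (t - s)

namespace Negligible

variable {T : ℝ} {A B : ℝ → ℝ → ℝ}

theorem add (hA : Negligible T A) (hB : Negligible T B) :
    Negligible T (fun s t => A s t + B s t) := by
  intro ε hε
  obtain ⟨δ, hδ, h1⟩ := hA (ε / 2) (by positivity)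
  obtain ⟨δ', hδ', h2⟩ := hB (ε / 2) (by positivity)
  refine ⟨min δ δ', lt_min hδ hδ', fun s t hs hst ht hd => ?_⟩
  have a := h1 s t hs hst ht (hd.trans_le (min_le_left _ _))
  have b := h2 s t hs hst ht (hd.trans_le (min_le_right _ _))
  have := abs_add_le (A s t) (B s t)
  linarith

theorem of_abs_le {K : ℝ} (hB : Negligible T B)
    (h : ∀ s t, 0 ≤ s → s ≤ t → t ≤ T → |A s t| ≤ K * |B s t|) : Negligible T A := by
  intro ε hε
  obtain ⟨δ, hδ, h1⟩ := hB (ε / (|K| + 1)) (by positivity)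
  refine ⟨δ, hδ, fun s t hs hst ht hd => ?_⟩
  have a := h1 s t hs hst ht hd
  calc |A s t| ≤ K * |B s t| := h s t hs hst ht
    _ ≤ (|K| + 1) * (ε / (|K| + 1) * (t - s)) := by
        gcongr
        linarith [le_abs_self K]
    _ = ε * (t - s) := by field_simp

theorem congr (hB : Negligible T B)
    (h : ∀ s t, 0 ≤ s → s ≤ t → t ≤ T → A s t = B s t) : Negligible T A :=
  hB.of_abs_le (K := 1) fun s t hs hst ht => by rw [h s t hs hst ht, one_mul]

theorem neg (hA : Negligible T A) : Negligible T (fun s t => -A s t) :=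
  hA.of_abs_le (K := 1) fun s t _ _ _ => by simp

theorem sub (hA : Negligible T A) (hB : Negligible T B) :
    Negligible T (fun s t => A s t - B s t) := by
  simpa only [sub_eq_add_neg] using hA.add hB.neg

/-- A factor bounded on `[0, T]` preserves negligibility. -/
theorem bdd_mul {b : ℝ → ℝ} {K : ℝ} (hb : ∀ s, 0 ≤ s → s ≤ T → |b s| ≤ K)
    (hA : Negligible T A) : Negligible T (fun s t => b s * A s t) :=
  hA.of_abs_le (K := K) fun s t hs hst ht => by
    rw [abs_mul]
    gcongr
    exact hb s hs (hst.trans ht)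

theorem of_le_rpow {K θ : ℝ} (hθ : 1 < θ)
    (h : ∀ s t, 0 ≤ s → s ≤ t → t ≤ T → |A s t| ≤ K * (t - s) ^ θ) : Negligible T A := by
  suffices hN : Negligible T (fun s t => (t - s) ^ θ) from
    hN.of_abs_le (K := K) fun s t hs hst ht => by
      rw [abs_of_nonneg (Real.rpow_nonneg (sub_nonneg.2 hst) θ)]
      exact h s t hs hst ht
  intro ε hε
  refine ⟨ε ^ (1 / (θ - 1)), by positivity, fun s t _ hst _ hd => ?_⟩
  have h0 : 0 ≤ t - s := sub_nonneg.2 hst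
  have hθ' : 0 < θ - 1 := by linarith
  rw [abs_of_nonneg (by positivity)]
  calc (t - s) ^ θ = (t - s) ^ (θ - 1) * (t - s) := by
        conv_lhs => rw [show θ = (θ - 1) + 1 by ring]
        rw [Real.rpow_add_of_nonneg h0 hθ'.le zero_le_one, Real.rpow_one]
    _ ≤ (ε ^ (1 / (θ - 1))) ^ (θ - 1) * (t - s) := by gcongr
    _ = ε * (t - s) := by
        rw [← Real.rpow_mul hε.le, one_div_mul_cancel hθ'.ne', Real.rpow_one]

end Negligible

variable {T : ℝ}

/-- If the increments of `J` are `f(s) (w(t) - w(s)) + o(t - s)`, then Riemann sums over partitions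
of mesh less than some `δ` are close to `J(t) - J(0)`. -/
theorem abs_sum_sub_le_of_negligible {f w J : ℝ → ℝ}
    (hJ : Negligible T (fun s t => J t - J s - f s * (w t - w s))) {ε : ℝ} (hε : 0 < ε) :
    ∃ δ > 0, ∀ t ≤ T, ∀ (n : ℕ) (p : ℕ → ℝ), p 0 = 0 → p n = t →
      (∀ i < n, p i ≤ p (i + 1) ∧ p (i + 1) - p i < δ) →
      |∑ i ∈ Finset.range n, f (p i) * (w (p (i + 1)) - w (p i)) - (J t - J 0)| ≤ ε * t := by
  obtain ⟨δ, hδ, h⟩ := hJ ε hε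
  refine ⟨δ, hδ, fun t ht n p hp0 hpn hp => ?_⟩
  have hmono : ∀ i j, i ≤ j → j ≤ n → p i ≤ p j := by
    intro i j hij
    induction j, hij using Nat.le_induction with
    | base => exact fun _ => le_rfl
    | succ k _ ih => exact fun hk => (ih (by omega)).trans (hp k (by omega)).1
  have e1 : J t - J 0 = ∑ i ∈ Finset.range n, (J (p (i + 1)) - J (p i)) := by
    rw [Finset.sum_range_sub (fun i => J (p i)), hp0, hpn]
  have e2 : t = ∑ i ∈ Finset.range n, (p (i + 1) - p i) := by
    rw [Finset.sum_range_sub, hp0, hpn, sub_zero]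
  rw [e1, ← Finset.sum_sub_distrib]
  conv_rhs => rw [e2]
  rw [Finset.mul_sum]
  refine (Finset.abs_sum_le_sum_abs _ _).trans (Finset.sum_le_sum fun i hi => ?_)
  have hi := Finset.mem_range.1 hi
  rw [abs_sub_comm]
  exact h _ _ (hp0 ▸ hmono 0 i (by omega) (by omega)) (hp i hi).1
    ((hmono (i + 1) n (by omega) le_rfl).trans (hpn.le.trans ht)) (hp i hi).2

/-- Partitions of `[0, t]` of arbitrarily small mesh exist. -/
theorem exists_partition {t δ : ℝ} (ht : 0 ≤ t) (hδ : 0 < δ) :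
    ∃ (n : ℕ) (p : ℕ → ℝ), p 0 = 0 ∧ p n = t ∧
      ∀ i < n, p i < p (i + 1) ∧ p (i + 1) - p i < δ := by
  rcases ht.eq_or_lt with rfl | ht
  · exact ⟨0, fun _ => 0, rfl, rfl, fun i hi => absurd hi (by omega)⟩
  obtain ⟨n, hn⟩ := exists_nat_gt (t / δ)
  have hn0 : (0 : ℝ) < n := lt_of_le_of_lt (by positivity) hn
  have hpos : 0 < t / n := by positivity
  refine ⟨n, fun i => i * (t / n), by simp, by field_simp, fun i _ => ?_⟩
  have : ((i + 1 : ℕ) : ℝ) * (t / n) - i * (t / n) = t / n := by push_cast; ring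
  refine ⟨by linarith, ?_⟩
  rw [this, div_lt_iff₀ hn0]
  rw [div_lt_iff₀ hδ] at hn
  linarith

/-- A function on `[0, T]` with uniformly negligible increments is constant. -/
theorem Negligible.eq_zero_of_increment {D : ℝ → ℝ} (hD : Negligible T (fun s t => D t - D s))
    {t : ℝ} (ht : t ∈ Set.Icc 0 T) : D t = D 0 := by
  have key : ∀ ε > 0, |D t - D 0| ≤ ε * t := by
    intro ε hε
    obtain ⟨δ, hδ, h⟩ := abs_sum_sub_le_of_negligible (f := fun _ => 0) (w := fun _ => 0)
      (by simpa using hD) hε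
    obtain ⟨n, p, h0, hn, hp⟩ := exists_partition ht.1 hδ
    simpa [abs_sub_comm (D 0)] using h t ht.2 n p h0 hn fun i hi => ⟨(hp i hi).1.le, (hp i hi).2⟩
  have : |D t - D 0| ≤ 0 := by
    refine le_of_forall_pos_le_add fun ε hε => ?_
    have h1 := key (ε / (t + 1)) (div_pos hε (by linarith [ht.1]))
    refine h1.trans ?_
    rw [zero_add, div_mul_eq_mul_div, div_le_iff₀ (by linarith [ht.1])]
    nlinarith [ht.1]
  exact sub_eq_zero.1 (abs_nonpos_iff.1 this)

theorem HasPathwiseIntegral.unique {f : ℝ → ℝ} {ω : PathSpace T} {t I I' : ℝ} (ht : 0 ≤ t)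
    (h : HasPathwiseIntegral f ω t I) (h' : HasPathwiseIntegral f ω t I') : I = I' := by
  by_contra hne
  have hpos : 0 < |I - I'| / 2 := by
    have := abs_pos.2 (sub_ne_zero.2 hne)
    positivity
  obtain ⟨δ, hδ, h1⟩ := h _ hpos
  obtain ⟨δ', hδ', h2⟩ := h' _ hpos
  obtain ⟨n, p, h0, hn, hp⟩ := exists_partition ht (lt_min hδ hδ')
  have a := h1 n p h0 hn fun i hi => ⟨(hp i hi).1, (hp i hi).2.trans_le (min_le_left _ _)⟩
  have b := h2 n p h0 hn fun i hi => ⟨(hp i hi).1, (hp i hi).2.trans_le (min_le_right _ _)⟩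
  rw [abs_sub_comm] at a
  have := abs_sub_le I (∑ i ∈ Finset.range n, f (p i) * (coord ω (p (i + 1)) - coord ω (p i))) I'
  linarith

theorem HasPathwiseIntegral.pathwiseIntegral_eq {f : ℝ → ℝ} {ω : PathSpace T} {t I : ℝ}
    (ht : 0 ≤ t) (h : HasPathwiseIntegral f ω t I) : pathwiseIntegral f ω t = I := by
  have hI : PathwiseIntegrable f ω t := ⟨I, h⟩
  rw [pathwiseIntegral, dif_pos hI]
  exact hI.choose_spec.unique ht h

theorem pathwiseIntegral_zero (f : ℝ → ℝ) (ω : PathSpace T) : pathwiseIntegral f ω 0 = 0 := by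
  refine HasPathwiseIntegral.pathwiseIntegral_eq le_rfl fun ε hε =>
    ⟨1, one_pos, fun n p h0 hn hp => ?_⟩
  -- a partition of `[0, 0]` into nondegenerate intervals is empty
  have hlt : ∀ i ≤ n, i ≠ 0 → 0 < p i := by
    intro i
    induction i with
    | zero => exact fun _ h => absurd rfl h
    | succ k ih =>
      intro hk _
      have h1 := (hp k (by omega)).1
      rcases Nat.eq_zero_or_pos k with rfl | hk0
      · rwa [h0] at h1
      · exact (ih (by omega) hk0.ne').trans h1
  obtain rfl : n = 0 := by
    by_contra hne
    exact (hlt n le_rfl hne).ne' hn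
  simpa using hε

/-- A function whose increments are `f(s) (B(t) - B(s)) + o(t - s)` is the pathwise integral
of `f`. -/
theorem hasPathwiseIntegral_of_negligible {f J : ℝ → ℝ} {ω : PathSpace T} (hJ0 : J 0 = 0)
    (hJ : Negligible T (fun s t => J t - J s - f s * (coord ω t - coord ω s)))
    {t : ℝ} (ht : t ∈ Set.Icc 0 T) : HasPathwiseIntegral f ω t (J t) := by
  intro ε hε
  have ht1 : 0 < t + 1 := by linarith [ht.1]
  obtain ⟨δ, hδ, h⟩ := abs_sum_sub_le_of_negligible hJ (div_pos hε ht1)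
  refine ⟨δ, hδ, fun n p h0 hn hp => ?_⟩
  have := h t ht.2 n p h0 hn fun i hi => ⟨(hp i hi).1.le, (hp i hi).2⟩
  rw [hJ0, sub_zero] at this
  refine this.trans_lt ?_
  rw [div_mul_eq_mul_div, div_lt_iff₀ ht1]
  nlinarith

/-! ### The sewing estimate of Young integration -/

/-- Young's estimate: a Riemann sum over any partition is close to its one-interval version,
with a constant that does not depend on the partition. The proof splits the partition at the
subinterval containing the midpoint, so that each of the two outer parts is at most half as long. -/
theorem abs_sum_sub_germ_le {f w : ℝ → ℝ} {a b K θ : ℝ} (hK : 0 ≤ K) (hθ : 1 < θ)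
    (hδ : ∀ s u t, a ≤ s → s ≤ u → u ≤ t → t ≤ b →
      |(f u - f s) * (w t - w u)| ≤ K * (t - s) ^ θ)
    {p : ℕ → ℝ} (hp : Monotone p) (N m n : ℕ) (hmn : m ≤ n) (hN : n - m ≤ N)
    (ha : a ≤ p m) (hb : p n ≤ b) :
    |∑ i ∈ Finset.Ico m n, f (p i) * (w (p (i + 1)) - w (p i)) - f (p m) * (w (p n) - w (p m))|
      ≤ 2 * K / (1 - 2 ^ (1 - θ)) * (p n - p m) ^ θ := by
  have hq : (2 : ℝ) ^ (1 - θ) < 1 := Real.rpow_lt_one_of_one_lt_of_neg one_lt_two (by linarith)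
  have hq' : 0 < 1 - (2 : ℝ) ^ (1 - θ) := by linarith
  have hM : 0 ≤ 2 * K / (1 - (2 : ℝ) ^ (1 - θ)) := by positivity
  induction N generalizing m n with
  | zero =>
    obtain rfl : m = n := by omega
    simpa using mul_nonneg hM (Real.rpow_nonneg le_rfl θ)
  | succ N ih =>
    rcases hmn.eq_or_lt with rfl | hlt
    · simpa using mul_nonneg hM (Real.rpow_nonneg le_rfl θ)
    have hL : 0 ≤ p n - p m := sub_nonneg.2 (hp hmn)
    obtain ⟨i, hmi, hin, hi1, hi2⟩ : ∃ i, m ≤ i ∧ i < n ∧ p i - p m ≤ (p n - p m) / 2 ∧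
        p n - p (i + 1) ≤ (p n - p m) / 2 := by
      by_contra! hcon
      have hall : ∀ i, m ≤ i → i < n → p i - p m ≤ (p n - p m) / 2 := by
        intro i hi
        induction i, hi using Nat.le_induction with
        | base => intro _; linarith
        | succ k hk ihk =>
          intro hkn
          have := hcon k hk (by omega) (ihk (by omega))
          linarith
      have := hcon (n - 1) (by omega) (by omega) (hall _ (by omega) (by omega))
      rw [show n - 1 + 1 = n by omega] at this
      linarith
    have e1 := ih m i hmi (by omega) ha ((hp hin.le).trans hb)
    have e2 := ih (i + 1) n hin (by omega) (ha.trans (hp (by omega))) hb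
    have d1 := hδ (p m) (p i) (p (i + 1)) ha (hp hmi) (hp (by omega)) ((hp hin).trans hb)
    have d2 := hδ (p m) (p (i + 1)) (p n) ha (hp (by omega)) (hp hin) hb
    have d1' : |(f (p i) - f (p m)) * (w (p (i + 1)) - w (p i))| ≤ K * (p n - p m) ^ θ := by
      refine d1.trans ?_
      gcongr
      · exact sub_nonneg.2 (hp (by omega))
      · exact hp hin
    set M := 2 * K / (1 - (2 : ℝ) ^ (1 - θ)) with hMdef
    have half : ((p n - p m) / 2) ^ θ = 2 ^ (1 - θ) / 2 * (p n - p m) ^ θ := by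
      rw [Real.div_rpow hL two_pos.le, Real.rpow_sub two_pos, Real.rpow_one]
      field_simp
    have e1' := e1.trans (mul_le_mul_of_nonneg_left
      (Real.rpow_le_rpow (sub_nonneg.2 (hp hmi)) hi1 (by linarith)) hM)
    have e2' := e2.trans (mul_le_mul_of_nonneg_left
      (Real.rpow_le_rpow (sub_nonneg.2 (hp hin)) hi2 (by linarith)) hM)
    rw [half] at e1' e2'
    have hMeq : M * (1 - (2 : ℝ) ^ (1 - θ)) = 2 * K := by
      rw [hMdef]; field_simp
    rw [← Finset.sum_Ico_consecutive _ hmi hin.le, Finset.sum_eq_sum_Ico_succ_bot hin]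
    set S1 := ∑ i ∈ Finset.Ico m i, f (p i) * (w (p (i + 1)) - w (p i))
    set S2 := ∑ i ∈ Finset.Ico (i + 1) n, f (p i) * (w (p (i + 1)) - w (p i))
    have : S1 + (f (p i) * (w (p (i + 1)) - w (p i)) + S2) - f (p m) * (w (p n) - w (p m))
        = (S1 - f (p m) * (w (p i) - w (p m))) +
          (S2 - f (p (i + 1)) * (w (p n) - w (p (i + 1)))) +
          (f (p i) - f (p m)) * (w (p (i + 1)) - w (p i)) +
          (f (p (i + 1)) - f (p m)) * (w (p n) - w (p (i + 1))) := by ring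
    rw [this]
    refine (abs_add_le _ _).trans ((add_le_add ((abs_add_le _ _).trans (add_le_add
      ((abs_add_le _ _).trans (add_le_add e1' e2')) d1')) d2).trans ?_)
    have : M * (p n - p m) ^ θ = M * ((2 : ℝ) ^ (1 - θ)) * (p n - p m) ^ θ
        + 2 * K * (p n - p m) ^ θ := by rw [← hMeq]; ring
    rw [this]
    apply le_of_eq
    ring

/-- The sewing lemma for the germ `f(s) (w(t) - w(s))`: the indefinite Young integral `J`. It is
obtained as a limit, along an ultrafilter, of the Riemann sums over uniform grids stopped at `t`. -/
theorem exists_young_integral {f w : ℝ → ℝ} {K θ : ℝ} (hT : 0 ≤ T) (hK : 0 ≤ K) (hθ : 1 < θ)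
    (hδ : ∀ s u t, 0 ≤ s → s ≤ u → u ≤ t → t ≤ T →
      |(f u - f s) * (w t - w u)| ≤ K * (t - s) ^ θ) :
    ∃ J : ℝ → ℝ, J 0 = 0 ∧ ∀ s t, 0 ≤ s → s ≤ t → t ≤ T →
      |J t - J s - f s * (w t - w s)| ≤ 2 * K / (1 - 2 ^ (1 - θ)) * (t - s) ^ θ := by
  set M := 2 * K / (1 - (2 : ℝ) ^ (1 - θ)) with hMdef
  let q : ℕ → ℕ → ℝ := fun n k => k * (T / (n + 1))
  let c : ℕ → ℝ → ℝ → ℕ → ℝ := fun n s t k => max s (min t (q n k))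
  let R : ℕ → ℝ → ℝ → ℝ := fun n s t => ∑ k ∈ Finset.range (n + 1),
    f (c n s t k) * (w (c n s t (k + 1)) - w (c n s t k))
  have hqmono : ∀ n, Monotone (q n) := fun n i k hik => by
    simp only [q]
    gcongr
  have hcmono : ∀ n s t, Monotone (c n s t) := fun n s t i k hik =>
    max_le_max le_rfl (min_le_min le_rfl (hqmono n hik))
  have hq0 : ∀ n, q n 0 = 0 := fun n => by simp [q]
  have hqn : ∀ n, q n (n + 1) = T := fun n => by
    simp only [q]; push_cast; field_simp
  have hc0 : ∀ n s t, 0 ≤ s → s ≤ t → c n s t 0 = s := fun n s t hs hst => by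
    simp only [c, hq0]
    rw [min_eq_right (hs.trans hst), max_eq_left hs]
  have hcn : ∀ n s t, s ≤ t → t ≤ T → c n s t (n + 1) = t := fun n s t hst ht => by
    simp only [c, hqn]
    rw [min_eq_left ht, max_eq_right hst]
  have hR : ∀ n s t, 0 ≤ s → s ≤ t → t ≤ T →
      |R n s t - f s * (w t - w s)| ≤ M * (t - s) ^ θ := by
    intro n s t hs hst ht
    have := abs_sum_sub_germ_le hK hθ hδ (hcmono n s t) (n + 1) 0 (n + 1) (by omega) (by omega)
      (by rw [hc0 n s t hs hst]; exact hs) (by rw [hcn n s t hst ht]; exact ht)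
    rw [hc0 n s t hs hst, hcn n s t hst ht, ← Finset.range_eq_Ico] at this
    exact this
  -- The sums are additive in the interval up to an error coming from one cell of the grid.
  have hadd : ∀ n s t, 0 ≤ s → s ≤ t → t ≤ T →
      |R n 0 t - R n 0 s - R n s t| ≤ K * (T / (n + 1)) ^ (θ - 1) * t := by
    intro n s t hs hst ht
    have et : t = ∑ k ∈ Finset.range (n + 1), (c n 0 t (k + 1) - c n 0 t k) := by
      rw [Finset.sum_range_sub, hcn n 0 t (hs.trans hst) ht, hc0 n 0 t le_rfl (hs.trans hst),
        sub_zero]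
    simp only [R]
    rw [← Finset.sum_sub_distrib, ← Finset.sum_sub_distrib]
    conv_rhs => rw [et]
    rw [Finset.mul_sum]
    refine (Finset.abs_sum_le_sum_abs _ _).trans (Finset.sum_le_sum fun k _ => ?_)
    have hmin : ∀ i, c n 0 s i = min s (c n 0 t i) := fun i => by
      simp only [c]
      rw [max_min_distrib_left, max_min_distrib_left, max_eq_right hs,
        max_eq_right (hs.trans hst), ← min_assoc, min_eq_left hst]
    have hmax : ∀ i, c n s t i = max s (c n 0 t i) := fun i => by
      simp only [c]
      rw [← max_assoc, max_eq_left hs]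
    rw [hmin, hmin, hmax, hmax]
    have hx0 : 0 ≤ c n 0 t k := le_max_left _ _
    have hyt : c n 0 t (k + 1) ≤ t := max_le (hs.trans hst) (min_le_left _ _)
    have hxy : c n 0 t k ≤ c n 0 t (k + 1) := hcmono n 0 t (Nat.le_succ k)
    have hstep : c n 0 t (k + 1) - c n 0 t k ≤ T / (n + 1) := by
      have hq1 : q n (k + 1) = q n k + T / (n + 1) := by
        simp only [q]; push_cast; ring
      have hTn : 0 ≤ T / ((n : ℝ) + 1) := by positivity
      simp only [c, hq1]
      rw [sub_le_iff_le_add]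
      refine max_le (by positivity) ?_
      have h1 := le_max_right 0 (min t (q n k))
      rcases le_total t (q n k) with h | h
      · have h2 := min_le_left t (q n k + T / (n + 1))
        rw [min_eq_left h] at h1 ⊢
        linarith
      · have h2 := min_le_right t (q n k + T / (n + 1))
        rw [min_eq_right h] at h1 ⊢
        linarith
    generalize c n 0 t k = x at *
    generalize c n 0 t (k + 1) = y at *
    have hyx : 0 ≤ y - x := sub_nonneg.2 hxy
    have hnonneg : 0 ≤ K * (T / ((n : ℝ) + 1)) ^ (θ - 1) * (y - x) := by positivity
    rcases le_total s x with hsx | hxs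
    · rw [min_eq_left hsx, min_eq_left (hsx.trans hxy), max_eq_right hsx,
        max_eq_right (hsx.trans hxy)]
      simpa using hnonneg
    rcases le_total y s with hys | hsy
    · rw [min_eq_right hys, min_eq_right hxs, max_eq_left hys, max_eq_left hxs]
      simpa using hnonneg
    rw [min_eq_left hsy, min_eq_right hxs, max_eq_right hsy, max_eq_left hxs]
    have e : f x * (w y - w x) - f x * (w s - w x) - f s * (w y - w s)
        = -((f s - f x) * (w y - w s)) := by ring
    rw [e, abs_neg]
    refine (hδ x s y hx0 hxs hsy (hyt.trans ht)).trans ?_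
    have e' : (y - x) ^ θ = (y - x) ^ (θ - 1) * (y - x) := by
      conv_lhs => rw [show θ = (θ - 1) + 1 by ring]
      rw [Real.rpow_add_of_nonneg hyx (by linarith) zero_le_one, Real.rpow_one]
    rw [e', mul_assoc]
    gcongr
  -- Limits along an ultrafilter exist because the sums are bounded.
  have hlim : ∀ t ∈ Set.Icc 0 T, ∃ l, Tendsto (fun n => R n 0 t) (hyperfilter ℕ) (𝓝 l) := by
    intro t ht
    have hb : ∀ n, R n 0 t ∈ Metric.closedBall (f 0 * (w t - w 0)) (M * (t - 0) ^ θ) := fun n => by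
      rw [Metric.mem_closedBall, Real.dist_eq]
      exact hR n 0 t le_rfl ht.1 ht.2
    obtain ⟨l, _, hl⟩ := (isCompact_closedBall (f 0 * (w t - w 0))
      (M * (t - 0) ^ θ)).ultrafilter_le_nhds ((hyperfilter ℕ).map (fun n => R n 0 t)) (by
        rw [Ultrafilter.coe_map, le_principal_iff]
        exact mem_map.2 (Filter.univ_mem' hb))
    exact ⟨l, hl⟩
  choose! J hJ using hlim
  have h00 : (0 : ℝ) ∈ Set.Icc 0 T := ⟨le_rfl, hT⟩
  have hzero : Tendsto (fun n : ℕ => T / ((n : ℝ) + 1)) (hyperfilter ℕ) (𝓝 0) := by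
    have := (tendsto_one_div_add_atTop_nhds_zero_nat (𝕜 := ℝ)).const_mul T
    rw [mul_zero] at this
    refine Tendsto.mono_left (by simpa [div_eq_mul_inv] using this) ?_
    exact Nat.hyperfilter_le_atTop
  refine ⟨J, ?_, fun s t hs hst ht => ?_⟩
  · have h0 : ∀ n, R n 0 0 = 0 := fun n => by
      have := hR n 0 0 le_rfl le_rfl hT
      simpa [Real.zero_rpow (show θ ≠ 0 by linarith)] using this
    have := hJ 0 h00
    simp only [h0] at this
    exact (tendsto_nhds_unique this tendsto_const_nhds)
  · have l1 := ((hJ t ⟨hs.trans hst, ht⟩).sub (hJ s ⟨hs, hst.trans ht⟩)).sub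
      (tendsto_const_nhds (x := f s * (w t - w s)))
    have l2 : Tendsto (fun n : ℕ => K * (T / ((n : ℝ) + 1)) ^ (θ - 1) * t + M * (t - s) ^ θ)
        (hyperfilter ℕ) (𝓝 (M * (t - s) ^ θ)) := by
      have h1 := hzero.rpow_const (p := θ - 1) (Or.inr (by linarith))
      rw [Real.zero_rpow (by linarith)] at h1
      simpa using ((h1.const_mul K).mul_const t).add_const (M * (t - s) ^ θ)
    refine le_of_tendsto_of_tendsto' l1.abs l2 fun n => ?_
    have a := hadd n s t hs hst ht
    have b := hR n s t hs hst ht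
    have e : R n 0 t - R n 0 s - f s * (w t - w s)
      = (R n 0 t - R n 0 s - R n s t) + (R n s t - f s * (w t - w s)) := by ring
    rw [e]
    exact (abs_add_le _ _).trans (add_le_add a b)

end PathSpace

namespace PathSpace

/-! ### Hölder regularity of the paths of fractional Brownian motion -/

/-- Chaining over dyadic grids: a continuous path whose increments over dyadic intervals of
generation `n` are `O(2 ^ (-n β))` is Hölder continuous of exponent `β`. -/
theorem holder_of_dyadic {T : ℝ} (hT : 0 < T) {g : ℝ → ℝ} (hg : ContinuousOn g (Set.Icc 0 T))
    {β C : ℝ} (hβ : 0 < β)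
    (hC : ∀ n k : ℕ, k < 2 ^ n →
      |g ((k + 1) * (T / 2 ^ n)) - g (k * (T / 2 ^ n))| ≤ C * ((2 : ℝ) ^ (-β)) ^ n) :
    ∃ C', ∀ s ∈ Set.Icc 0 T, ∀ t ∈ Set.Icc 0 T, |g s - g t| ≤ C' * |s - t| ^ β := by
  set r : ℝ := (2 : ℝ) ^ (-β) with hr
  have hr0 : 0 < r := by positivity
  have hr1 : r < 1 := Real.rpow_lt_one_of_one_lt_of_neg one_lt_two (by linarith)
  have hC0 : 0 ≤ C := by
    have := (abs_nonneg _).trans (hC 0 0 (by simp))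
    simpa using this
  let fl : ℕ → ℝ → ℕ := fun n s => ⌊s / (T / 2 ^ n)⌋₊
  let a : ℕ → ℝ → ℝ := fun n s => fl n s * (T / 2 ^ n)
  have hd : ∀ n : ℕ, 0 < T / 2 ^ n := fun n => by positivity
  have ha1 : ∀ n s, 0 ≤ s → a n s ≤ s := fun n s hs => by
    have := Nat.floor_le (div_nonneg hs (hd n).le)
    exact (le_div_iff₀ (hd n)).1 this
  have ha2 : ∀ n s, s < a n s + T / 2 ^ n := fun n s => by
    have := Nat.lt_floor_add_one (s / (T / 2 ^ n))
    rw [div_lt_iff₀ (hd n)] at this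
    simp only [a, fl]
    linarith
  have ha0 : ∀ n s, 0 ≤ a n s := fun n s => mul_nonneg (Nat.cast_nonneg _) (hd n).le
  have hfl : ∀ n s, s ≤ T → fl n s ≤ 2 ^ n := fun n s hs => by
    have h1 : s / (T / 2 ^ n) ≤ ((2 ^ n : ℕ) : ℝ) := by
      rw [div_le_iff₀ (hd n)]; push_cast; field_simp; exact hs
    exact Nat.floor_le_of_le h1
  -- The grid points below `s` at consecutive generations differ by at most one step.
  have hstep : ∀ n s, 0 ≤ s → s ≤ T → dist (g (a n s)) (g (a (n + 1) s)) ≤ C * r * r ^ n := by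
    intro n s hs hsT
    have h2 : T / 2 ^ n = 2 * (T / 2 ^ (n + 1)) := by rw [pow_succ]; field_simp
    have hu1 := ha1 (n + 1) s hs
    have hu2 := ha2 (n + 1) s
    have hl1 := ha1 n s hs
    have hl2 := ha2 n s
    have hdn := hd (n + 1)
    have hea : a n s = ((2 * fl n s : ℕ) : ℝ) * (T / 2 ^ (n + 1)) := by
      simp only [a]; rw [h2]; push_cast; ring
    have hea' : a (n + 1) s = (fl (n + 1) s : ℝ) * (T / 2 ^ (n + 1)) := rfl
    have i1 : 2 * fl n s ≤ fl (n + 1) s := by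
      have : ((2 * fl n s : ℕ) : ℝ) < ((fl (n + 1) s + 1 : ℕ) : ℝ) := by
        refine lt_of_mul_lt_mul_right ?_ hdn.le
        rw [← hea]; push_cast; rw [add_mul, ← hea']; linarith
      have := Nat.cast_lt.1 this
      omega
    have i2 : fl (n + 1) s ≤ 2 * fl n s + 1 := by
      have : ((fl (n + 1) s : ℕ) : ℝ) < ((2 * fl n s + 2 : ℕ) : ℝ) := by
        refine lt_of_mul_lt_mul_right ?_ hdn.le
        rw [← hea', Nat.cast_add, add_mul, ← hea]; push_cast; linarith
      have := Nat.cast_lt.1 this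
      omega
    rcases (show fl (n + 1) s = 2 * fl n s ∨ fl (n + 1) s = 2 * fl n s + 1 by omega) with h | h
    · rw [hea, hea', h, dist_self]; positivity
    · have := hC (n + 1) (2 * fl n s) (by have := hfl (n + 1) s hsT; omega)
      rw [hea, hea', h, dist_comm, Real.dist_eq, mul_assoc, mul_comm r, ← pow_succ]
      push_cast at this ⊢
      exact this
  have hlim : ∀ s ∈ Set.Icc 0 T, Tendsto (fun n => g (a n s)) atTop (𝓝 (g s)) := by
    intro s hs
    refine (hg s hs).tendsto.comp (tendsto_nhdsWithin_iff.2 ⟨?_, Filter.Eventually.of_forall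
      fun n => ⟨ha0 n s, (ha1 n s hs.1).trans hs.2⟩⟩)
    have h0 : Tendsto (fun n : ℕ => s - T / 2 ^ n) atTop (𝓝 s) := by
      have := (tendsto_pow_atTop_nhds_zero_of_lt_one (r := (1 / 2 : ℝ)) (by norm_num)
        (by norm_num)).const_mul T
      have := this.const_sub s
      simpa [div_eq_mul_inv] using this
    exact tendsto_of_tendsto_of_tendsto_of_le_of_le h0 tendsto_const_nhds
      (fun n => by have := ha2 n s; simp only; linarith) (fun n => ha1 n s hs.1)
  have happ : ∀ s ∈ Set.Icc 0 T, ∀ n, |g (a n s) - g s| ≤ C * r * r ^ n / (1 - r) := by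
    intro s hs n
    exact dist_le_of_le_geometric_of_tendsto r (C * r) hr1 (fun n => hstep n s hs.1 hs.2)
      (hlim s hs) n
  have h1r : 0 < 1 - r := by linarith
  set C2 := C * r / (1 - r) + C + C * r / (1 - r) with hC2
  have hC2' : 0 ≤ C2 := by positivity
  refine ⟨C2 * (2 / T) ^ β, ?_⟩
  have main : ∀ s t, 0 ≤ s → s < t → t ≤ T → |g s - g t| ≤ C2 * (2 / T) ^ β * |s - t| ^ β := by
    intro s t hs hst ht
    have hpos : 0 < (t - s) / T := div_pos (by linarith) hT
    have hle1 : (t - s) / T ≤ 1 := (div_le_one hT).2 (by linarith)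
    -- the generation `n` with `T 2 ^ (-(n + 1)) < t - s ≤ T 2 ^ (-n)`
    obtain ⟨n, hn1, hn2⟩ := exists_nat_pow_near_of_lt_one hpos hle1 (y := (1 / 2 : ℝ))
      (by norm_num) (by norm_num)
    have hts : t - s ≤ T / 2 ^ n := by
      rw [div_le_iff₀ hT] at hn2
      calc t - s ≤ (1 / 2) ^ n * T := hn2
        _ = T / 2 ^ n := by rw [one_div_pow]; ring
    have hmid : |g (a n s) - g (a n t)| ≤ C * r ^ n := by
      have i1 : fl n s ≤ fl n t := Nat.floor_mono (by have := hd n; gcongr)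
      have i2 : fl n t ≤ fl n s + 1 := by
        have : ((fl n t : ℕ) : ℝ) < ((fl n s + 2 : ℕ) : ℝ) := by
          refine lt_of_mul_lt_mul_right ?_ (hd n).le
          have u1 := ha1 n t (hs.trans hst.le)
          have u2 := ha2 n s
          simp only [a] at u1 u2
          push_cast
          linarith
        have := Nat.cast_lt.1 this
        omega
      rcases (show fl n t = fl n s ∨ fl n t = fl n s + 1 by omega) with h | h
      · simp only [a, h, sub_self, abs_zero]; positivity
      · have := hC n (fl n s) (by have := hfl n t ht; omega)
        simp only [a, h]
        rw [abs_sub_comm]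
        push_cast
        exact this
    have b1 := happ s ⟨hs, hst.le.trans ht⟩ n
    have b2 := happ t ⟨hs.trans hst.le, ht⟩ n
    have b3 : |g s - g t| ≤ C2 * r ^ n := by
      have e : g s - g t = -(g (a n s) - g s) + (g (a n s) - g (a n t)) + (g (a n t) - g t) := by
        ring
      rw [e]
      refine (abs_add_three _ _ _).trans ?_
      rw [abs_neg]
      refine (add_le_add (add_le_add b1 hmid) b2).trans (le_of_eq ?_)
      rw [hC2]; ring
    refine b3.trans ?_
    rw [mul_assoc]
    refine mul_le_mul_of_nonneg_left ?_ hC2'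
    have hts0 : 0 < t - s := by linarith
    rw [abs_sub_comm, abs_of_pos hts0, ← Real.mul_rpow (by positivity) hts0.le]
    have e : r ^ n = ((1 / 2 : ℝ) ^ n) ^ β := by
      rw [hr, ← Real.rpow_natCast, ← Real.rpow_mul two_pos.le, one_div, inv_pow,
        Real.inv_rpow (by positivity), ← Real.rpow_natCast, ← Real.rpow_mul two_pos.le,
        ← Real.rpow_neg two_pos.le]
      congr 1; ring
    rw [e]
    refine Real.rpow_le_rpow (by positivity) ?_ hβ.le
    rw [pow_succ] at hn1
    have : 2 / T * (t - s) = 2 * ((t - s) / T) := by ring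
    rw [this]
    linarith
  intro s hs t ht
  rcases lt_trichotomy s t with h | rfl | h
  · exact main s t hs.1 h ht.2
  · simp [Real.zero_rpow hβ.ne']
  · rw [abs_sub_comm, abs_sub_comm s t]; exact main t s ht.1 h hs.2

open ProbabilityTheory in
/-- Absolute moments of a centred real Gaussian variable scale with its standard deviation. -/
theorem lintegral_abs_pow_gaussianReal (m : ℕ) {σ : ℝ} (hσ : 0 ≤ σ) :
    ∫⁻ x, ENNReal.ofReal (|x| ^ m) ∂(gaussianReal 0 (σ ^ 2).toNNReal)
      = ENNReal.ofReal (σ ^ m) * ∫⁻ x, ENNReal.ofReal (|x| ^ m) ∂(gaussianReal 0 1) := by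
  have h : gaussianReal 0 (σ ^ 2).toNNReal = (gaussianReal 0 1).map (σ * ·) := by
    rw [gaussianReal_map_const_mul]
    congr 1
    · simp
    · ext; simp [sq_nonneg]
  rw [h, lintegral_map (by fun_prop) (by fun_prop), ← lintegral_const_mul _ (by fun_prop)]
  refine lintegral_congr fun x => ?_
  rw [← ENNReal.ofReal_mul (by positivity), abs_mul, mul_pow, abs_of_nonneg hσ]

open ProbabilityTheory in
theorem lintegral_abs_pow_gaussianReal_lt_top (m : ℕ) :
    ∫⁻ x, ENNReal.ofReal (|x| ^ m) ∂(gaussianReal 0 1) < ⊤ := by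
  have h := (memLp_id_gaussianReal (μ := 0) (v := 1) (m : NNReal)).integrable_norm_pow'
  have := h.lintegral_lt_top
  simpa using this

open ProbabilityTheory in
/-- The moments of the increments of fractional Brownian motion. -/
theorem IsFBMLaw.lintegral_increment {T H : ℝ} [MeasurableSpace (PathSpace T)]
    [BorelSpace (PathSpace T)] {P : Measure (PathSpace T)} (hP : IsFBMLaw H P) (hH : 0 < H)
    (s t : Set.Icc (0 : ℝ) T) (m : ℕ) :
    ∫⁻ ω : PathSpace T, ENNReal.ofReal (|ω t - ω s| ^ m) ∂P
      = ENNReal.ofReal ((|(t : ℝ) - s| ^ H) ^ m) *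
        ∫⁻ x, ENNReal.ofReal (|x| ^ m) ∂(gaussianReal 0 1) := by
  have hg := hP.gaussian.hasGaussianLaw_fun_sub (s := t) (t := s)
  have := hP.isProbability
  have hLt := (hP.gaussian.hasGaussianLaw_eval t).memLp_two
  have hLs := (hP.gaussian.hasGaussianLaw_eval s).memLp_two
  have hmean : ∫ ω : PathSpace T, (ω t - ω s) ∂P = 0 := by
    rw [integral_sub (hLt.integrable one_le_two) (hLs.integrable one_le_two), hP.centered,
      hP.centered, sub_zero]
  have hvar : Var[fun ω : PathSpace T => ω t - ω s; P] = (|(t : ℝ) - s| ^ H) ^ 2 := by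
    rw [variance_of_integral_eq_zero hg.aemeasurable hmean]
    have e : ∀ ω : PathSpace T, (ω t - ω s) ^ 2 = ω t * ω t - 2 * (ω s * ω t) + ω s * ω s :=
      fun ω => by ring
    simp only [e]
    have itt : Integrable (fun ω : PathSpace T => ω t * ω t) P := hLt.integrable_mul hLt
    have ist : Integrable (fun ω : PathSpace T => ω s * ω t) P := hLs.integrable_mul hLt
    have iss : Integrable (fun ω : PathSpace T => ω s * ω s) P := hLs.integrable_mul hLs
    have h2 : Integrable (fun ω : PathSpace T => ω t * ω t - 2 * (ω s * ω t)) P :=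
      itt.sub (ist.const_mul 2)
    rw [integral_add h2 iss, integral_sub itt (ist.const_mul 2),
      integral_const_mul, hP.covariance, hP.covariance, hP.covariance]
    simp only [sub_self, abs_zero]
    rw [Real.zero_rpow (by linarith), ← Real.rpow_natCast, ← Real.rpow_mul (abs_nonneg _),
      mul_comm H, Nat.cast_ofNat, abs_sub_comm (s : ℝ) t]
    ring
  have hlaw := hg.map_eq_gaussianReal
  rw [hmean, hvar] at hlaw
  rw [← lintegral_abs_pow_gaussianReal m (by positivity), ← hlaw,
    lintegral_map' (by fun_prop) hg.aemeasurable]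

/-- Under a fractional Brownian law, almost every path is Hölder continuous of a given
exponent `β < H`. -/
theorem IsFBMLaw.ae_holder {T H : ℝ} (hT : 0 < T) [MeasurableSpace (PathSpace T)]
    [BorelSpace (PathSpace T)] {P : Measure (PathSpace T)} (hP : IsFBMLaw H P) {β : ℝ}
    (hβ : 0 < β) (hβH : β < H) :
    ∀ᵐ ω ∂P, ∃ C : ℝ, ∀ s t : Set.Icc (0 : ℝ) T,
      |ω s - ω t| ≤ C * |(s : ℝ) - (t : ℝ)| ^ β := by
  -- a moment of order `m` with `m (H - β) > 1` beats the number of dyadic intervals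
  obtain ⟨m, hm⟩ := exists_nat_gt (1 / (H - β))
  have hHβ : 0 < H - β := by linarith
  have hm1 : 1 < m * (H - β) := by rwa [div_lt_iff₀ hHβ] at hm
  have hm0 : m ≠ 0 := by rintro rfl; norm_num at hm1
  have hmem : ∀ n k : ℕ, k ≤ 2 ^ n → (k : ℝ) * (T / 2 ^ n) ∈ Set.Icc 0 T := fun n k hk => by
    refine ⟨by positivity, ?_⟩
    have : (k : ℝ) ≤ 2 ^ n := by exact_mod_cast hk
    calc (k : ℝ) * (T / 2 ^ n) ≤ 2 ^ n * (T / 2 ^ n) := by gcongr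
      _ = T := by field_simp
  let pt : ℕ → ℕ → Set.Icc (0 : ℝ) T := fun n k =>
    Set.projIcc 0 T hT.le ((k : ℝ) * (T / 2 ^ n))
  have hpt : ∀ n k : ℕ, k ≤ 2 ^ n → ((pt n k : Set.Icc (0 : ℝ) T) : ℝ) = k * (T / 2 ^ n) :=
    fun n k hk => by simp only [pt]; rw [Set.projIcc_of_mem hT.le (hmem n k hk)]
  set c := ∫⁻ x, ENNReal.ofReal (|x| ^ m) ∂(ProbabilityTheory.gaussianReal 0 1) with hc
  let Y : ℕ → PathSpace T → ENNReal := fun n ω => ∑ k ∈ Finset.range (2 ^ n),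
    ENNReal.ofReal ((((2 : ℝ) ^ β) ^ n) ^ m) * ENNReal.ofReal (|ω (pt n (k + 1)) - ω (pt n k)| ^ m)
  have hYk : ∀ n k, Measurable fun ω : PathSpace T => ENNReal.ofReal ((((2 : ℝ) ^ β) ^ n) ^ m) *
      ENNReal.ofReal (|ω (pt n (k + 1)) - ω (pt n k)| ^ m) := fun n k => by
    refine Measurable.const_mul (ENNReal.measurable_ofReal.comp (Continuous.measurable ?_)) _
    fun_prop
  have hYm : ∀ n, Measurable (Y n) := fun n => Finset.measurable_sum _ fun k _ => hYk n k
  set ρ : ℝ := 2 * ((2 : ℝ) ^ (β - H)) ^ m with hρ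
  have hρ0 : 0 ≤ ρ := by positivity
  have hρ1 : ρ < 1 := by
    rw [hρ, ← Real.rpow_natCast, ← Real.rpow_mul two_pos.le]
    calc (2 : ℝ) * 2 ^ ((β - H) * m) = 2 ^ (1 + (β - H) * m) := by
          rw [Real.rpow_add two_pos, Real.rpow_one]
      _ < 1 := Real.rpow_lt_one_of_one_lt_of_neg one_lt_two (by linarith)
  have hYint : ∀ n, ∫⁻ ω, Y n ω ∂P = ENNReal.ofReal (ρ ^ n * (T ^ H) ^ m) * c := by
    intro n
    simp only [Y]
    rw [lintegral_finsetSum _ fun k _ => hYk n k]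
    have : ∀ k ∈ Finset.range (2 ^ n), ∫⁻ ω : PathSpace T, ENNReal.ofReal ((((2 : ℝ) ^ β) ^ n) ^ m)
        * ENNReal.ofReal (|ω (pt n (k + 1)) - ω (pt n k)| ^ m) ∂P
        = ENNReal.ofReal ((((2 : ℝ) ^ β) ^ n) ^ m) *
          (ENNReal.ofReal (((T / 2 ^ n) ^ H) ^ m) * c) := by
      intro k hk
      have hk := Finset.mem_range.1 hk
      rw [lintegral_const_mul' _ _ ENNReal.ofReal_ne_top,
        hP.lintegral_increment (by linarith) (pt n k) (pt n (k + 1)) m,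
        hpt n k hk.le, hpt n (k + 1) hk]
      have : ((k + 1 : ℕ) : ℝ) * (T / 2 ^ n) - k * (T / 2 ^ n) = T / 2 ^ n := by push_cast; ring
      rw [this, abs_of_pos (by positivity)]
    rw [Finset.sum_congr rfl this, Finset.sum_const, Finset.card_range, nsmul_eq_mul, ← mul_assoc,
      ← mul_assoc]
    congr 1
    rw [← ENNReal.ofReal_natCast, ← ENNReal.ofReal_mul (by positivity),
      ← ENNReal.ofReal_mul (by positivity)]
    congr 1
    have e1 : (T / 2 ^ n) ^ H = T ^ H * (((2 : ℝ) ^ (-H)) ^ n) := by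
      rw [Real.div_rpow hT.le (by positivity), ← Real.rpow_natCast 2 n,
        ← Real.rpow_mul two_pos.le, ← Real.rpow_natCast (2 ^ (-H)) n, ← Real.rpow_mul two_pos.le,
        div_eq_mul_inv, ← Real.rpow_neg two_pos.le]
      congr 2; ring
    have e2 : (2 : ℝ) ^ (β - H) = 2 ^ β * 2 ^ (-H) := by
      rw [← Real.rpow_add two_pos, sub_eq_add_neg]
    rw [e1, hρ, e2]
    push_cast
    generalize (2 : ℝ) ^ β = x
    generalize (2 : ℝ) ^ (-H) = y
    rw [mul_pow, mul_pow, mul_pow, mul_pow, pow_right_comm x, pow_right_comm y]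
    ring
  have hsum : ∫⁻ ω, ∑' n, Y n ω ∂P ≠ ⊤ := by
    rw [lintegral_tsum fun n => (hYm n).aemeasurable]
    simp only [hYint]
    rw [ENNReal.tsum_mul_right]
    refine ENNReal.mul_ne_top ?_ (lintegral_abs_pow_gaussianReal_lt_top m).ne
    exact ((summable_geometric_of_lt_one hρ0 hρ1).mul_right _).tsum_ofReal_ne_top
  filter_upwards [ae_lt_top (Measurable.tsum hYm) hsum] with ω hω
  set S := (∑' n, Y n ω).toReal with hS
  have hS0 : 0 ≤ S := ENNReal.toReal_nonneg
  have hbound : ∀ n k : ℕ, k < 2 ^ n →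
      |ω (pt n (k + 1)) - ω (pt n k)| ≤ S ^ ((m : ℝ)⁻¹) * ((2 : ℝ) ^ (-β)) ^ n := by
    intro n k hk
    have h1 : ENNReal.ofReal ((((2 : ℝ) ^ β) ^ n) ^ m) *
        ENNReal.ofReal (|ω (pt n (k + 1)) - ω (pt n k)| ^ m) ≤ ∑' n, Y n ω :=
      (Finset.single_le_sum (f := fun k => ENNReal.ofReal ((((2 : ℝ) ^ β) ^ n) ^ m) *
        ENNReal.ofReal (|ω (pt n (k + 1)) - ω (pt n k)| ^ m)) (fun _ _ => zero_le)
        (Finset.mem_range.2 hk)).trans (ENNReal.le_tsum n)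
    rw [← ENNReal.ofReal_mul (by positivity), ← mul_pow] at h1
    have h2 := (ENNReal.ofReal_le_iff_le_toReal hω.ne).1 h1
    have h3 : ((2 : ℝ) ^ β) ^ n * |ω (pt n (k + 1)) - ω (pt n k)| ≤ S ^ ((m : ℝ)⁻¹) := by
      rw [← Real.pow_rpow_inv_natCast (x := ((2 : ℝ) ^ β) ^ n * |ω (pt n (k + 1)) - ω (pt n k)|)
        (by positivity) hm0]
      exact Real.rpow_le_rpow (by positivity) h2 (by positivity)
    rw [Real.rpow_neg two_pos.le, inv_pow, ← div_eq_mul_inv, le_div_iff₀ (by positivity)]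
    linarith
  obtain ⟨C', hC'⟩ := holder_of_dyadic hT (g := fun s => ω (Set.projIcc 0 T hT.le s))
    (ω.continuous.comp continuous_projIcc).continuousOn hβ fun n k hk => by
      have := hbound n k hk
      simp only [pt] at this
      push_cast at this
      exact this
  refine ⟨C', fun s t => ?_⟩
  have := hC' s s.2 t t.2
  simpa using this

theorem IsFBMLaw.ae_mem_holderPaths {T H : ℝ} (hT : 0 < T) (hH : 0 < H)
    [MeasurableSpace (PathSpace T)] [BorelSpace (PathSpace T)] {P : Measure (PathSpace T)}
    (hP : IsFBMLaw H P) : ∀ᵐ ω ∂P, ω ∈ holderPaths T H := by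
  have h : ∀ᵐ ω ∂P, ∀ n : ℕ, ∃ C : ℝ, ∀ s t : Set.Icc (0 : ℝ) T,
      |ω s - ω t| ≤ C * |(s : ℝ) - (t : ℝ)| ^ (H - H / (n + 2)) := by
    refine ae_all_iff.2 fun n => hP.ae_holder hT ?_ ?_
    · rw [sub_pos]; exact div_lt_self hH (by linarith [(Nat.cast_nonneg n : (0 : ℝ) ≤ n)])
    · rw [sub_lt_self_iff]; positivity
  filter_upwards [h] with ω hω β hβ hβH
  obtain ⟨n, hn⟩ := exists_nat_gt (H / (H - β))
  obtain ⟨C, hC⟩ := hω n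
  have hle : β ≤ H - H / (n + 2) := by
    have hd : 0 < H - β := by linarith
    rw [div_lt_iff₀ hd] at hn
    rw [le_sub_comm, div_le_iff₀ (by positivity)]
    nlinarith
  refine ⟨|C| * T ^ (H - H / (n + 2) - β), fun s t => ?_⟩
  have hst : |(s : ℝ) - t| ≤ T :=
    abs_sub_le_iff.2 ⟨by linarith [s.2.2, t.2.1], by linarith [t.2.2, s.2.1]⟩
  calc |ω s - ω t| ≤ C * |(s : ℝ) - t| ^ (H - H / (n + 2)) := hC s t
    _ ≤ |C| * (T ^ (H - H / (n + 2) - β) * |(s : ℝ) - t| ^ β) := by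
        gcongr
        · exact le_abs_self C
        · exact rpow_le_mul_rpow (abs_nonneg _) hst hβ hle
    _ = |C| * T ^ (H - H / (n + 2) - β) * |(s : ℝ) - t| ^ β := by ring

end PathSpace

namespace PathSpace

/-! ### Hölder bounds and Young integrals on the path space -/

/-- `f` is Hölder continuous on `[0, T]` of exponent `α`, with constant `C`. -/
def HolderBound (T α C : ℝ) (f : ℝ → ℝ) : Prop :=
  ∀ s t, 0 ≤ s → s ≤ t → t ≤ T → |f t - f s| ≤ C * (t - s) ^ α

variable {T : ℝ}

theorem HolderBound.abs_sub_le {α C : ℝ} {f : ℝ → ℝ} (hf : HolderBound T α C f) {s t : ℝ}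
    (hs : s ∈ Set.Icc 0 T) (ht : t ∈ Set.Icc 0 T) : |f t - f s| ≤ C * |t - s| ^ α := by
  rcases le_total s t with h | h
  · rw [abs_of_nonneg (sub_nonneg.2 h)]
    exact hf s t hs.1 h ht.2
  · rw [abs_sub_comm, abs_sub_comm t, abs_of_nonneg (sub_nonneg.2 h)]
    exact hf t s ht.1 h hs.2

theorem continuousOn_of_holder_local {α C δ : ℝ} {f : ℝ → ℝ} (hα : 0 < α) (hδ : 0 < δ)
    (hf : ∀ s t, 0 ≤ s → s ≤ t → t ≤ T → t - s < δ → |f t - f s| ≤ C * (t - s) ^ α) :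
    ContinuousOn f (Set.Icc 0 T) := by
  intro s hs
  rw [ContinuousWithinAt, tendsto_iff_dist_tendsto_zero]
  have h0 : Tendsto (fun t => C * |t - s| ^ α) (𝓝[Set.Icc 0 T] s) (𝓝 0) := by
    have hc : Continuous fun t : ℝ => C * |t - s| ^ α :=
      continuous_const.mul ((continuous_id.sub continuous_const).abs.rpow_const
        fun _ => Or.inr hα.le)
    have := hc.tendsto s
    simp only [sub_self, abs_zero, Real.zero_rpow hα.ne', mul_zero] at this
    exact this.mono_left nhdsWithin_le_nhds
  refine squeeze_zero' (Eventually.of_forall fun _ => dist_nonneg) ?_ h0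
  filter_upwards [self_mem_nhdsWithin, mem_nhdsWithin_of_mem_nhds (Metric.ball_mem_nhds s hδ)]
    with t ht htδ
  rw [Metric.mem_ball, Real.dist_eq] at htδ
  rw [Real.dist_eq]
  rcases le_total s t with h | h
  · rw [abs_of_nonneg (sub_nonneg.2 h)] at htδ ⊢
    exact hf s t hs.1 h ht.2 htδ
  · rw [abs_sub_comm, abs_of_nonneg (sub_nonneg.2 h)] at htδ
    rw [abs_sub_comm, abs_sub_comm t, abs_of_nonneg (sub_nonneg.2 h)]
    exact hf t s ht.1 h hs.2 htδ

theorem HolderBound.continuousOn {α C : ℝ} {f : ℝ → ℝ} (hα : 0 < α) (hf : HolderBound T α C f) :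
    ContinuousOn f (Set.Icc 0 T) :=
  continuousOn_of_holder_local hα one_pos fun s t hs hst ht _ => hf s t hs hst ht

theorem HolderBound.mono_exponent {α μ C : ℝ} {f : ℝ → ℝ} (hα : 0 < α) (hαμ : α ≤ μ) (hC : 0 ≤ C)
    (hf : HolderBound T μ C f) : HolderBound T α (C * T ^ (μ - α)) f := by
  intro s t hs hst ht
  refine (hf s t hs hst ht).trans ?_
  rw [mul_assoc]
  gcongr
  exact rpow_le_mul_rpow (sub_nonneg.2 hst) (by linarith) hα hαμ

theorem HolderBound.add {α C D : ℝ} {f g : ℝ → ℝ} (hf : HolderBound T α C f)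
    (hg : HolderBound T α D g) : HolderBound T α (C + D) (fun s => f s + g s) := by
  intro s t hs hst ht
  have e : f t + g t - (f s + g s) = (f t - f s) + (g t - g s) := by ring
  rw [e, add_mul]
  exact (abs_add_le _ _).trans (add_le_add (hf s t hs hst ht) (hg s t hs hst ht))

theorem HolderBound.mul {α C D K L : ℝ} {f g : ℝ → ℝ} (hK : ∀ s ∈ Set.Icc 0 T, |f s| ≤ K)
    (hL : ∀ s ∈ Set.Icc 0 T, |g s| ≤ L) (hf : HolderBound T α C f)
    (hg : HolderBound T α D g) : HolderBound T α (K * D + L * C) (fun s => f s * g s) := by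
  intro s t hs hst ht
  have e : f t * g t - f s * g s = f t * (g t - g s) + g s * (f t - f s) := by ring
  have hs' : s ∈ Set.Icc 0 T := ⟨hs, hst.trans ht⟩
  have ht' : t ∈ Set.Icc 0 T := ⟨hs.trans hst, ht⟩
  have hK0 := (abs_nonneg _).trans (hK t ht')
  have hL0 := (abs_nonneg _).trans (hL s hs')
  rw [e]
  calc |f t * (g t - g s) + g s * (f t - f s)|
      ≤ |f t| * |g t - g s| + |g s| * |f t - f s| := by
        rw [← abs_mul, ← abs_mul]; exact abs_add_le _ _
    _ ≤ K * (D * (t - s) ^ α) + L * (C * (t - s) ^ α) := by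
        gcongr
        · exact hK t ht'
        · exact hg s t hs hst ht
        · exact hL s hs'
        · exact hf s t hs hst ht
    _ = (K * D + L * C) * (t - s) ^ α := by ring

/-- A Hölder bound at scales smaller than some `δ` implies a global one. -/
theorem HolderBound.of_local {α C δ : ℝ} {f : ℝ → ℝ} (hα : 0 < α) (hC : 0 ≤ C) (hδ : 0 < δ)
    (hf : ∀ s t, 0 ≤ s → s ≤ t → t ≤ T → t - s < δ → |f t - f s| ≤ C * (t - s) ^ α) :
    ∃ C', 0 ≤ C' ∧ HolderBound T α C' f := by
  obtain ⟨K, hK⟩ := isCompact_Icc.exists_bound_of_continuousOn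
    (continuousOn_of_holder_local hα hδ hf)
  refine ⟨C + 2 * |K| / δ ^ α, by positivity, fun s t hs hst ht => ?_⟩
  have hts := sub_nonneg.2 hst
  rw [add_mul]
  rcases lt_or_ge (t - s) δ with h | h
  · exact (hf s t hs hst ht h).trans (le_add_of_nonneg_right (by positivity))
  · refine le_add_of_nonneg_of_le (by positivity) ?_
    calc |f t - f s| ≤ |f t| + |f s| := abs_sub _ _
      _ ≤ 2 * |K| := by
        have h1 : |f t| ≤ K := hK t ⟨hs.trans hst, ht⟩
        have h2 : |f s| ≤ K := hK s ⟨hs, hst.trans ht⟩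
        have := le_abs_self K
        linarith
      _ = 2 * |K| / δ ^ α * δ ^ α := by
        have : δ ^ α ≠ 0 := (Real.rpow_pos_of_pos hδ α).ne'
        field_simp
      _ ≤ 2 * |K| / δ ^ α * (t - s) ^ α := by gcongr

theorem coord_of_mem {ω : PathSpace T} {s : ℝ} (hs : s ∈ Set.Icc 0 T) :
    coord ω s = ω ⟨s, hs⟩ := by
  rw [coord, dif_pos hs]

theorem exists_holderBound_coord {H β : ℝ} {ω : PathSpace T} (hω : ω ∈ holderPaths T H)
    (hβ : 0 < β) (hβH : β < H) : ∃ C, 0 ≤ C ∧ HolderBound T β C (coord ω) := by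
  obtain ⟨C, hC⟩ := hω β hβ hβH
  refine ⟨|C|, abs_nonneg C, fun s t hs hst ht => ?_⟩
  have hs' : s ∈ Set.Icc 0 T := ⟨hs, hst.trans ht⟩
  have ht' : t ∈ Set.Icc 0 T := ⟨hs.trans hst, ht⟩
  have h0 := sub_nonneg.2 hst
  rw [coord_of_mem hs', coord_of_mem ht']
  refine (hC ⟨t, ht'⟩ ⟨s, hs'⟩).trans ?_
  rw [abs_of_nonneg h0]
  gcongr
  exact le_abs_self C

/-- The pathwise integral of an `α`-Hölder function against a `β`-Hölder path with `α + β > 1`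
exists and is the Young integral, with an explicit remainder constant. -/
theorem young_pathwiseIntegral {f : ℝ → ℝ} {ω : PathSpace T} {α β Cf Cw : ℝ} (hT : 0 ≤ T)
    (hα : 0 < α) (hβ : 0 < β) (hθ : 1 < α + β) (hCf : 0 ≤ Cf) (hCw : 0 ≤ Cw)
    (hf : HolderBound T α Cf f) (hw : HolderBound T β Cw (coord ω)) :
    (∀ t ∈ Set.Icc 0 T, PathwiseIntegrable f ω t) ∧
      ∀ s t, 0 ≤ s → s ≤ t → t ≤ T →
        |pathwiseIntegral f ω t - pathwiseIntegral f ω s - f s * (coord ω t - coord ω s)|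
          ≤ 2 * (Cf * Cw) / (1 - 2 ^ (1 - (α + β))) * (t - s) ^ (α + β) := by
  obtain ⟨J, hJ0, hJ⟩ := exists_young_integral (f := f) (w := coord ω) (K := Cf * Cw) hT
    (by positivity) hθ fun s u t hs hsu hut ht => by
      have h1 := hf s u hs hsu (hut.trans ht)
      have h2 := hw u t (hs.trans hsu) hut ht
      have hsu' := sub_nonneg.2 hsu
      have hut' := sub_nonneg.2 hut
      have hst : 0 ≤ t - s := by linarith
      rw [abs_mul, Real.rpow_add_of_nonneg hst hα.le hβ.le]
      calc |f u - f s| * |coord ω t - coord ω u|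
          ≤ (Cf * (u - s) ^ α) * (Cw * (t - u) ^ β) := by gcongr
        _ ≤ (Cf * (t - s) ^ α) * (Cw * (t - s) ^ β) := by gcongr
        _ = Cf * Cw * ((t - s) ^ α * (t - s) ^ β) := by ring
  have hI : ∀ t ∈ Set.Icc 0 T, HasPathwiseIntegral f ω t (J t) := fun t ht =>
    hasPathwiseIntegral_of_negligible hJ0 (Negligible.of_le_rpow hθ hJ) ht
  have hE : ∀ t ∈ Set.Icc 0 T, pathwiseIntegral f ω t = J t := fun t ht =>
    (hI t ht).pathwiseIntegral_eq ht.1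
  refine ⟨fun t ht => ⟨_, hI t ht⟩, fun s t hs hst ht => ?_⟩
  rw [hE t ⟨hs.trans hst, ht⟩, hE s ⟨hs, hst.trans ht⟩]
  exact hJ s t hs hst ht

/-- The indefinite Young integral is as regular as the integrating path. -/
theorem holderBound_pathwiseIntegral {f : ℝ → ℝ} {ω : PathSpace T} {α β Cf Cw : ℝ} (hT : 0 ≤ T)
    (hα : 0 < α) (hβ : 0 < β) (hθ : 1 < α + β) (hCf : 0 ≤ Cf) (hCw : 0 ≤ Cw)
    (hf : HolderBound T α Cf f) (hw : HolderBound T β Cw (coord ω)) :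
    ∃ C, 0 ≤ C ∧ HolderBound T β C (pathwiseIntegral f ω) := by
  obtain ⟨K, hK⟩ := isCompact_Icc.exists_bound_of_continuousOn (hf.continuousOn hα)
  have hJ := (young_pathwiseIntegral hT hα hβ hθ hCf hCw hf hw).2
  have hM : 0 ≤ 2 * (Cf * Cw) / (1 - (2 : ℝ) ^ (1 - (α + β))) :=
    div_nonneg (by positivity) (sub_nonneg.2
      (Real.rpow_le_one_of_one_le_of_nonpos one_le_two (by linarith)))
  set M := 2 * (Cf * Cw) / (1 - (2 : ℝ) ^ (1 - (α + β)))
  refine ⟨|K| * Cw + M * T ^ α, by positivity, fun s t hs hst ht => ?_⟩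
  have h0 := sub_nonneg.2 hst
  have h1 := hJ s t hs hst ht
  have h2 := hw s t hs hst ht
  have h3 : |f s| ≤ |K| := (hK s ⟨hs, hst.trans ht⟩).trans (le_abs_self K)
  rw [Real.rpow_add_of_nonneg h0 hα.le hβ.le] at h1
  have e : pathwiseIntegral f ω t - pathwiseIntegral f ω s = f s * (coord ω t - coord ω s)
      + (pathwiseIntegral f ω t - pathwiseIntegral f ω s - f s * (coord ω t - coord ω s)) := by
    ring
  rw [e]
  calc _ ≤ |f s| * |coord ω t - coord ω s| + M * ((t - s) ^ α * (t - s) ^ β) := by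
        rw [← abs_mul]
        exact (abs_add_le _ _).trans (add_le_add le_rfl h1)
    _ ≤ |K| * (Cw * (t - s) ^ β) + M * (T ^ α * (t - s) ^ β) := by
        gcongr
        linarith
    _ = _ := by ring

theorem add_mem_holderPaths {H : ℝ} {ω k : PathSpace T} (hω : ω ∈ holderPaths T H)
    (hk : k ∈ holderPaths T H) : ω + k ∈ holderPaths T H := by
  intro β hβ hβH
  obtain ⟨C, hC⟩ := hω β hβ hβH
  obtain ⟨D, hD⟩ := hk β hβ hβH
  refine ⟨C + D, fun s t => ?_⟩
  have e : (ω + k) s - (ω + k) t = (ω s - ω t) + (k s - k t) := by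
    simp only [ContinuousMap.add_apply]; ring
  rw [e, add_mul]
  exact (abs_add_le _ _).trans (add_le_add (hC s t) (hD s t))

theorem smul_mem_holderPaths {H : ℝ} (c : ℝ) {k : PathSpace T} (hk : k ∈ holderPaths T H) :
    c • k ∈ holderPaths T H := by
  intro β hβ hβH
  obtain ⟨D, hD⟩ := hk β hβ hβH
  refine ⟨|c| * D, fun s t => ?_⟩
  have e : (c • k) s - (c • k) t = c * (k s - k t) := by
    simp only [ContinuousMap.smul_apply, smul_eq_mul]; ring
  rw [e, abs_mul, mul_assoc]
  gcongr
  exact hD s t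

theorem intervalIntegrable_of_continuousOn_Icc {v : ℝ → ℝ} (hv : ContinuousOn v (Set.Icc 0 T))
    {s t : ℝ} (hs : s ∈ Set.Icc 0 T) (ht : t ∈ Set.Icc 0 T) :
    IntervalIntegrable v volume s t :=
  (hv.mono (Set.uIcc_subset_Icc hs ht)).intervalIntegrable

theorem integral_sub_integral_of_continuousOn {v : ℝ → ℝ} (hv : ContinuousOn v (Set.Icc 0 T))
    {s t : ℝ} (hs : s ∈ Set.Icc 0 T) (ht : t ∈ Set.Icc 0 T) :
    (∫ u in (0 : ℝ)..t, v u) - ∫ u in (0 : ℝ)..s, v u = ∫ u in s..t, v u := by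
  have h0 : (0 : ℝ) ∈ Set.Icc 0 T := ⟨le_rfl, hs.1.trans hs.2⟩
  exact intervalIntegral.integral_interval_sub_left
    (intervalIntegrable_of_continuousOn_Icc hv h0 ht)
    (intervalIntegrable_of_continuousOn_Icc hv h0 hs)

theorem holderBound_integral {v : ℝ → ℝ} {K : ℝ} (hv : ContinuousOn v (Set.Icc 0 T))
    (hK : ∀ u ∈ Set.Icc 0 T, |v u| ≤ K) :
    HolderBound T 1 K (fun s => ∫ u in (0 : ℝ)..s, v u) := by
  intro s t hs hst ht
  rw [integral_sub_integral_of_continuousOn hv ⟨hs, hst.trans ht⟩ ⟨hs.trans hst, ht⟩,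
    Real.rpow_one]
  have := intervalIntegral.norm_integral_le_of_norm_le_const (f := v) (a := s) (b := t) (C := K)
    fun u hu => by
      rw [Set.uIoc_of_le hst] at hu
      exact hK u ⟨hs.trans hu.1.le, hu.2.trans ht⟩
  rwa [abs_of_nonneg (sub_nonneg.2 hst)] at this

theorem primitivePath_mem_holderPaths {H : ℝ} (hH : H ≤ 1) {v : ℝ → ℝ}
    (hv : ContinuousOn v (Set.Icc 0 T)) : primitivePath T v ∈ holderPaths T H := by
  intro β hβ hβH
  obtain ⟨K, hK⟩ := isCompact_Icc.exists_bound_of_continuousOn hv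
  have h := (holderBound_integral hv (K := |K|) fun u hu => (hK u hu).trans (le_abs_self K)
    ).mono_exponent hβ (by linarith : β ≤ 1) (abs_nonneg K)
  refine ⟨|K| * T ^ (1 - β), fun s t => ?_⟩
  rw [primitivePath_apply hv, primitivePath_apply hv]
  exact h.abs_sub_le t.2 s.2

theorem coord_transform {h : ℝ → ℝ → PathSpace T → ℝ} {r : ℝ} {ω : PathSpace T}
    (hv : ContinuousOn (fun u => h r u ω) (Set.Icc 0 T)) {s : ℝ} (hs : s ∈ Set.Icc 0 T) :
    coord (transform h r ω) s = coord ω s + ∫ u in (0 : ℝ)..s, h r u ω := by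
  rw [coord_of_mem hs, coord_of_mem hs, transform, ContinuousMap.add_apply,
    primitivePath_apply hv]

/-! ### Uniform first-order expansions -/

/-- The integral over a short interval of a family continuous in the parameter as well. -/
theorem negligible_integral {v : ℝ → ℝ → ℝ}
    (hv : ContinuousOn (fun p : ℝ × ℝ => v p.1 p.2) (Set.Icc 0 T ×ˢ Set.Icc 0 T)) :
    Negligible T (fun s t => (∫ u in s..t, v s u) - v s s * (t - s)) := by
  intro ε hε
  have hu := (isCompact_Icc.prod isCompact_Icc).uniformContinuousOn_of_continuous hv
  obtain ⟨δ, hδ, h⟩ := Metric.uniformContinuousOn_iff.1 hu ε hε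
  refine ⟨δ, hδ, fun s t hs hst ht hd => ?_⟩
  have hs' : s ∈ Set.Icc 0 T := ⟨hs, hst.trans ht⟩
  have ht' : t ∈ Set.Icc 0 T := ⟨hs.trans hst, ht⟩
  have hc : ContinuousOn (fun u => v s u) (Set.Icc 0 T) :=
    hv.comp (f := fun u => (s, u)) (by fun_prop) fun u hu => ⟨hs', hu⟩
  have e : (∫ u in s..t, v s u) - v s s * (t - s) = ∫ u in s..t, (v s u - v s s) := by
    rw [intervalIntegral.integral_sub (intervalIntegrable_of_continuousOn_Icc hc hs' ht')
      intervalIntegrable_const, intervalIntegral.integral_const, smul_eq_mul, mul_comm]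
  simp only
  rw [e, ← Real.norm_eq_abs, ← abs_of_nonneg (sub_nonneg.2 hst)]
  refine intervalIntegral.norm_integral_le_of_norm_le_const fun u hu => ?_
  rw [Set.uIoc_of_le hst] at hu
  have hu' : u ∈ Set.Icc 0 T := ⟨hs.trans hu.1.le, hu.2.trans ht⟩
  refine (h (s, u) ⟨hs', hu'⟩ (s, s) ⟨hs', hs'⟩ ?_).le
  rw [Prod.dist_eq]
  simp only [dist_self, Real.dist_eq]
  rw [max_eq_right (abs_nonneg _), abs_of_nonneg (by linarith [hu.1])]
  linarith [hu.2]

theorem negligible_integral_sub {v : ℝ → ℝ} (hv : ContinuousOn v (Set.Icc 0 T)) :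
    Negligible T (fun s t => (∫ u in (0 : ℝ)..t, v u) - (∫ u in (0 : ℝ)..s, v u)
      - v s * (t - s)) :=
  (negligible_integral (v := fun _ u => v u)
    (hv.comp continuousOn_snd fun _ hp => hp.2)).congr fun s t hs hst ht => by
      rw [integral_sub_integral_of_continuousOn hv ⟨hs, hst.trans ht⟩ ⟨hs.trans hst, ht⟩]

/-- The increment in `t` of `F(t, x, Γ(r))`, at `x = X(s)` and `r = s`: the integral against the
path `Γ(s)` splits into the integral against `ω` and the drift `h`. The sewing constant is uniform
in `s` because all the paths `Γ(s)` share one Hölder bound. -/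
theorem negligible_fieldF_time {h : ℝ → ℝ → PathSpace T → ℝ} {ω : PathSpace T}
    {η : ℝ → PathSpace T → ℝ} {f₀ f₁ : ℝ → ℝ → PathSpace T → ℝ} {X : ℝ → ℝ}
    {α β Cw C R : ℝ} (hT : 0 ≤ T) (hα : 0 < α) (hβ : 0 < β) (hβ1 : β ≤ 1) (hθ : 1 < α + β)
    (hCw : 0 ≤ Cw) (hw : HolderBound T β Cw (coord ω))
    (hh : ContinuousOn (fun p : ℝ × ℝ => h p.1 p.2 ω) (Set.Icc 0 T ×ˢ Set.Icc 0 T))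
    (hX : ContinuousOn X (Set.Icc 0 T)) (hXR : ∀ s ∈ Set.Icc 0 T, |X s| ≤ R)
    (hf₀ : ContinuousOn (fun p : ℝ × ℝ × ℝ => f₀ p.1 p.2.1 (transform h p.2.2 ω))
        (Set.Icc 0 T ×ˢ Set.univ ×ˢ Set.Icc 0 T)) (hC : 0 ≤ C)
    (hf₁ : ∀ r ∈ Set.Icc 0 T, ∀ x, |x| ≤ R →
      HolderBound T α C (fun s => f₁ s x (transform h r ω)))
    (hf₁c : ContinuousOn (fun s => f₁ s (X s) (transform h s ω)) (Set.Icc 0 T)) :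
    Negligible T (fun s t => fieldF η f₀ f₁ t (X s) (transform h s ω)
      - fieldF η f₀ f₁ s (X s) (transform h s ω)
      - (f₀ s (X s) (transform h s ω) * (t - s)
        + f₁ s (X s) (transform h s ω) * (h s s ω * (t - s))
        + f₁ s (X s) (transform h s ω) * (coord ω t - coord ω s))) := by
  obtain ⟨Ch, hCh⟩ := (isCompact_Icc.prod isCompact_Icc).exists_bound_of_continuousOn hh
  obtain ⟨K, hK⟩ := isCompact_Icc.exists_bound_of_continuousOn hf₁c
  have hhr : ∀ r ∈ Set.Icc 0 T, ContinuousOn (fun u => h r u ω) (Set.Icc 0 T) := fun r hr =>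
    hh.comp (f := fun u => (r, u)) (by fun_prop) fun u hu => ⟨hr, hu⟩
  have hγ : ∀ r ∈ Set.Icc 0 T,
      HolderBound T β (Cw + |Ch| * T ^ (1 - β)) (coord (transform h r ω)) := by
    intro r hr s t hs hst ht
    rw [coord_transform (hhr r hr) ⟨hs, hst.trans ht⟩,
      coord_transform (hhr r hr) ⟨hs.trans hst, ht⟩]
    exact hw.add ((holderBound_integral (hhr r hr) fun u hu => (hCh (r, u) ⟨hr, hu⟩).trans
      (le_abs_self Ch)).mono_exponent hβ hβ1 (abs_nonneg _)) s t hs hst ht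
  have hf₀x : ∀ r ∈ Set.Icc 0 T, ∀ x,
      ContinuousOn (fun u => f₀ u x (transform h r ω)) (Set.Icc 0 T) := fun r hr x =>
    hf₀.comp (f := fun u => (u, x, r)) (by fun_prop) fun u hu => ⟨hu, trivial, hr⟩
  have N1 : Negligible T (fun s t =>
      pathwiseIntegral (fun u => f₁ u (X s) (transform h s ω)) (transform h s ω) t
      - pathwiseIntegral (fun u => f₁ u (X s) (transform h s ω)) (transform h s ω) s
      - f₁ s (X s) (transform h s ω) *
        (coord (transform h s ω) t - coord (transform h s ω) s)) :=
    Negligible.of_le_rpow hθ fun s t hs hst ht =>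
      (young_pathwiseIntegral hT hα hβ hθ hC (by positivity)
        (hf₁ s ⟨hs, hst.trans ht⟩ (X s) (hXR s ⟨hs, hst.trans ht⟩))
        (hγ s ⟨hs, hst.trans ht⟩)).2 s t hs hst ht
  have N2 := negligible_integral (T := T) (v := fun s u => f₀ u (X s) (transform h s ω)) <| by
    refine hf₀.comp (f := fun p : ℝ × ℝ => (p.2, X p.1, p.1)) ?_ fun p hp => ⟨hp.2, trivial, hp.1⟩
    exact continuousOn_snd.prodMk ((hX.comp continuousOn_fst fun p hp => hp.1).prodMk
      continuousOn_fst)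
  have N3 := (negligible_integral (v := fun s u => h s u ω) hh).bdd_mul
    (b := fun s => f₁ s (X s) (transform h s ω)) fun s hs hsT => hK s ⟨hs, hsT⟩
  refine ((N1.add N2).add N3).congr fun s t hs hst ht => ?_
  have hs' : s ∈ Set.Icc 0 T := ⟨hs, hst.trans ht⟩
  have ht' : t ∈ Set.Icc 0 T := ⟨hs.trans hst, ht⟩
  simp only [fieldF]
  rw [coord_transform (hhr s hs') hs', coord_transform (hhr s hs') ht',
    ← integral_sub_integral_of_continuousOn (hf₀x s hs' (X s)) hs' ht',
    ← integral_sub_integral_of_continuousOn (hhr s hs') hs' ht']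
  ring

theorem abs_sub_sub_deriv_mul_le {g : ℝ → ℝ} (hg : Differentiable ℝ g) {a b c K : ℝ}
    (h : ∀ y ∈ Set.uIcc a b, |deriv g y - c| ≤ K) :
    |g b - g a - c * (b - a)| ≤ K * |b - a| := by
  have hd : ∀ y ∈ Set.uIcc a b, HasDerivWithinAt (fun y => g y - c * y) (deriv g y - c)
      (Set.uIcc a b) y := fun y _ => by
    have := ((hg y).hasDerivAt.sub ((hasDerivAt_id y).const_mul c)).hasDerivWithinAt
      (s := Set.uIcc a b)
    rw [mul_one] at this
    exact this
  have := (convex_uIcc a b).norm_image_sub_le_of_norm_hasDerivWithin_le hd h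
    Set.left_mem_uIcc Set.right_mem_uIcc
  have e : g b - g a - c * (b - a) = g b - c * b - (g a - c * a) := by ring
  rw [e]
  exact this

/-- The increment in `x`: a first-order Taylor expansion suffices, because the remainder is of
order `(t - s) ^ (α + β)`. -/
theorem negligible_space_increment {Φ : ℝ → ℝ → PathSpace T → ℝ} {γ : ℝ → PathSpace T}
    {X : ℝ → ℝ} {α β C CX R : ℝ} (hα : 0 < α) (hαβ : α ≤ β) (hθ : 1 < α + β)
    (hC : 0 ≤ C) (hCX : 0 ≤ CX)
    (hX : HolderBound T β CX X) (hXR : ∀ s ∈ Set.Icc 0 T, |X s| ≤ R)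
    (hΦ : ∀ r ∈ Set.Icc 0 T, ∀ t ∈ Set.Icc 0 T, Differentiable ℝ (fun y => Φ t y (γ r)))
    (hΦx : ∀ r ∈ Set.Icc 0 T, ∀ s ∈ Set.Icc 0 T, ∀ t ∈ Set.Icc 0 T, ∀ x y, |x| ≤ R → |y| ≤ R →
      |partialX Φ s x (γ r) - partialX Φ t y (γ r)| ≤ C * (|s - t| ^ α + |x - y|)) :
    Negligible T (fun s t => Φ t (X t) (γ s) - Φ t (X s) (γ s)
      - partialX Φ s (X s) (γ s) * (X t - X s)) := by
  refine Negligible.of_le_rpow (K := C * (1 + CX * T ^ (β - α)) * CX) hθ fun s t hs hst ht => ?_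
  have hs' : s ∈ Set.Icc 0 T := ⟨hs, hst.trans ht⟩
  have ht' : t ∈ Set.Icc 0 T := ⟨hs.trans hst, ht⟩
  have h0 := sub_nonneg.2 hst
  have hT : 0 ≤ T := hs.trans hs'.2
  have hinc := hX s t hs hst ht
  have hlow : (t - s) ^ β ≤ T ^ (β - α) * (t - s) ^ α :=
    rpow_le_mul_rpow h0 (by linarith) hα hαβ
  have hbd : ∀ y ∈ Set.uIcc (X s) (X t),
      |deriv (fun y => Φ t y (γ s)) y - partialX Φ s (X s) (γ s)|
        ≤ C * (1 + CX * T ^ (β - α)) * (t - s) ^ α := by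
    intro y hy
    have hyR : |y| ≤ R := by
      have h1 := abs_le.1 (hXR s hs')
      have h2 := abs_le.1 (hXR t ht')
      have := Set.uIcc_subset_Icc (show X s ∈ Set.Icc (-R) R from h1)
        (show X t ∈ Set.Icc (-R) R from h2) hy
      exact abs_le.2 this
    have h1 := hΦx s hs' t ht' s hs' y (X s) hyR (hXR s hs')
    rw [abs_of_nonneg h0] at h1
    have h2 : |y - X s| ≤ |X t - X s| := Set.abs_sub_left_of_mem_uIcc hy
    refine h1.trans ?_
    rw [mul_assoc]
    gcongr
    calc (t - s) ^ α + |y - X s| ≤ (t - s) ^ α + CX * (T ^ (β - α) * (t - s) ^ α) := by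
          gcongr
          exact h2.trans (hinc.trans (by gcongr))
      _ = (1 + CX * T ^ (β - α)) * (t - s) ^ α := by ring
  refine (abs_sub_sub_deriv_mul_le (hΦ s hs' t ht') hbd).trans ?_
  rw [Real.rpow_add_of_nonneg h0 hα.le (hα.le.trans hαβ)]
  calc C * (1 + CX * T ^ (β - α)) * (t - s) ^ α * |X t - X s|
      ≤ C * (1 + CX * T ^ (β - α)) * (t - s) ^ α * (CX * (t - s) ^ β) := by gcongr
    _ = C * (1 + CX * T ^ (β - α)) * CX * ((t - s) ^ α * (t - s) ^ β) := by ring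

/-- A function continuous on `S` is uniformly close at points of `S` to its values on a compact
subset of `S`. -/
theorem exists_uniform_of_isCompact {A : Type*} [PseudoMetricSpace A] {f : A → ℝ} {S K : Set A}
    (hf : ContinuousOn f S) (hK : IsCompact K) (hKS : K ⊆ S) {ε : ℝ} (hε : 0 < ε) :
    ∃ δ > 0, ∀ x ∈ K, ∀ y ∈ S, dist x y < δ → |f x - f y| < ε := by
  have hK' : IsCompact ((↑) ⁻¹' K : Set S) :=
    Topology.IsInducing.subtypeVal.isCompact_preimage_iff (by simpa using hKS) |>.2 hK
  have h := hK'.uniformContinuousAt_of_continuousAt (S.domRestrict f)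
    (fun a _ => hf.domRestrict.continuousAt) (Metric.dist_mem_uniformity hε)
  obtain ⟨δ, hδ, h⟩ := Metric.mem_uniformity_dist.1 h
  exact ⟨δ, hδ, fun x hx y hy hxy => h (a := ⟨x, hKS hx⟩) (b := ⟨y, hy⟩) hxy hx⟩

section Curve

variable {E : Type*} [NormedAddCommGroup E] [NormedSpace ℝ E]

/-- The increment of `Φ` along a `C¹` curve `ω + j(κ(r))`, the other arguments staying fixed. The
functional is only differentiable in fixed directions, so the mean value theorem is applied on the
segment from `κ(s)` to `κ(t)`. -/
theorem negligible_curve_increment {H : ℝ} {j : E →L[ℝ] PathSpace T}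
    {Φ : ℝ → ℝ → PathSpace T → ℝ} {D : ℝ → ℝ → PathSpace T → (E →L[ℝ] ℝ)}
    (hΦ : IsC1AlongE H j Φ D) {ω : PathSpace T} (hω : ω ∈ holderPaths T H)
    {κ κ' : ℝ → E} (hκ : ∀ t ∈ Set.Icc 0 T, HasDerivWithinAt κ (κ' t) (Set.Icc 0 T) t)
    (hκ' : ContinuousOn κ' (Set.Icc 0 T)) (hκH : ∀ t ∈ Set.Icc 0 T, j (κ t) ∈ holderPaths T H)
    {X : ℝ → ℝ} (hX : ContinuousOn X (Set.Icc 0 T)) :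
    ContinuousOn (fun s => D s (X s) (ω + j (κ s)) (κ' s)) (Set.Icc 0 T) ∧
    Negligible T (fun s t => Φ t (X t) (ω + j (κ t)) - Φ t (X t) (ω + j (κ s))
      - D s (X s) (ω + j (κ s)) (κ' s) * (t - s)) := by
  have hκc : ContinuousOn κ (Set.Icc 0 T) := fun t ht => (hκ t ht).continuousWithinAt
  set q : ℝ → ℝ × ℝ × E × E := fun s => (s, X s, κ s, κ' s) with hq
  have hqc : ContinuousOn q (Set.Icc 0 T) :=
    continuousOn_id.prodMk (hX.prodMk (hκc.prodMk hκ'))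
  have hqS : Set.MapsTo q (Set.Icc 0 T)
      {p | p.1 ∈ Set.Icc (0 : ℝ) T ∧ j p.2.2.1 ∈ holderPaths T H} :=
    fun s hs => ⟨hs, hκH s hs⟩
  have hD := (hΦ ω hω).2
  refine ⟨hD.comp hqc hqS, fun ε hε => ?_⟩
  obtain ⟨δ₁, hδ₁, h1⟩ := exists_uniform_of_isCompact hD (isCompact_Icc.image_of_continuousOn hqc)
    (Set.image_subset_iff.2 hqS) hε
  obtain ⟨δ₂, hδ₂, h2⟩ := Metric.uniformContinuousOn_iff.1
    (isCompact_Icc.uniformContinuousOn_of_continuous hqc) (δ₁ / 2) (by positivity)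
  refine ⟨min δ₂ δ₁, lt_min hδ₂ hδ₁, fun s t hs hst ht hd => ?_⟩
  have hs' : s ∈ Set.Icc 0 T := ⟨hs, hst.trans ht⟩
  have ht' : t ∈ Set.Icc 0 T := ⟨hs.trans hst, ht⟩
  rcases hst.eq_or_lt with rfl | hlt
  · simp
  have hts : 0 < t - s := sub_pos.2 hlt
  have hnear : ∀ u ∈ Set.Icc s t, dist (q u) (q s) < δ₁ / 2 := fun u hu => by
    refine h2 u ⟨hs.trans hu.1, hu.2.trans ht⟩ s hs' ?_
    rw [Real.dist_eq, abs_of_nonneg (by linarith [hu.1])]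
    have := min_le_left δ₂ δ₁
    linarith [hu.2]
  -- the difference quotient of `κ` is close to its derivative
  have hquot : dist ((t - s)⁻¹ • (κ t - κ s)) (κ' s) < δ₁ := by
    have hb := norm_image_sub_le_of_norm_deriv_le_segment' (f := fun u => κ u - (u - s) • κ' s)
      (f' := fun u => κ' u - κ' s) (a := s) (b := t) (C := δ₁ / 2)
      (fun u hu => by
        have a1 := (hκ u ⟨hs.trans hu.1, hu.2.trans ht⟩).mono
          (show Set.Icc s t ⊆ Set.Icc 0 T from Set.Icc_subset_Icc hs ht)
        have a2 := (((hasDerivAt_id u).sub_const s).smul_const (κ' s)).hasDerivWithinAt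
          (s := Set.Icc s t)
        have a3 := a1.sub a2
        rw [one_smul] at a3
        exact a3)
      (fun u hu => by
        have := hnear u ⟨hu.1, hu.2.le⟩
        simp only [hq, Prod.dist_eq, max_lt_iff] at this
        rw [← dist_eq_norm]
        exact this.2.2.2.le) t ⟨hst, le_rfl⟩
    have e : (t - s)⁻¹ • (κ t - κ s) - κ' s
        = (t - s)⁻¹ • (κ t - (t - s) • κ' s - (κ s - (s - s) • κ' s)) := by
      rw [sub_self, zero_smul, sub_zero, smul_sub, smul_sub, smul_sub, smul_smul,
        inv_mul_cancel₀ hts.ne', one_smul]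
      abel
    rw [dist_eq_norm, e, norm_smul, norm_inv, Real.norm_eq_abs, abs_of_pos hts]
    calc (t - s)⁻¹ * ‖κ t - (t - s) • κ' s - (κ s - (s - s) • κ' s)‖
        ≤ (t - s)⁻¹ * (δ₁ / 2 * (t - s)) := by gcongr
      _ = δ₁ / 2 := by field_simp
      _ < δ₁ := by linarith
  have hmemθ : ∀ θ : ℝ, j (κ s + θ • (κ t - κ s)) ∈ holderPaths T H := fun θ => by
    have e : j (κ s + θ • (κ t - κ s)) = j (κ s) + θ • (j (κ t) + (-1 : ℝ) • j (κ s)) := by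
      rw [map_add, map_smul, map_sub, neg_one_smul, sub_eq_add_neg]
    rw [e]
    exact add_mem_holderPaths (hκH s hs') (smul_mem_holderPaths θ
      (add_mem_holderPaths (hκH t ht') (smul_mem_holderPaths (-1) (hκH s hs'))))
  have hmemk : j (κ t - κ s) ∈ holderPaths T H := by
    rw [map_sub, sub_eq_add_neg, ← neg_one_smul ℝ (j (κ s))]
    exact add_mem_holderPaths (hκH t ht') (smul_mem_holderPaths (-1) (hκH s hs'))
  have hderiv : ∀ θ : ℝ, HasDerivAt (fun θ : ℝ => Φ t (X t) (ω + j (κ s + θ • (κ t - κ s))))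
      (D t (X t) (ω + j (κ s + θ • (κ t - κ s))) (κ t - κ s)) θ := by
    intro θ
    rw [hasDerivAt_iff_tendsto_slope_zero]
    have := (hΦ _ (add_mem_holderPaths hω (hmemθ θ))).1 t ht' (X t) _ hmemk
    refine this.congr fun ε => ?_
    rw [smul_eq_mul, inv_mul_eq_div, add_smul, ← add_assoc (κ s), map_add j (κ s + _), map_smul j ε,
      ← add_assoc ω]
  obtain ⟨θ, hθ, hθeq⟩ := exists_hasDerivAt_eq_slope
    (fun θ : ℝ => Φ t (X t) (ω + j (κ s + θ • (κ t - κ s)))) _ zero_lt_one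
    (fun θ _ => (hderiv θ).continuousAt.continuousWithinAt) (fun θ _ => hderiv θ)
  rw [one_smul, zero_smul, add_zero, sub_zero, div_one, add_sub_cancel] at hθeq
  have hclose := h1 (q s) ⟨s, hs', rfl⟩
    (t, X t, κ s + θ • (κ t - κ s), (t - s)⁻¹ • (κ t - κ s)) ⟨ht', hmemθ θ⟩ (by
      have hn := hnear t ⟨hst, le_rfl⟩
      simp only [hq, Prod.dist_eq, max_lt_iff] at hn ⊢
      refine ⟨?_, ?_, ?_, ?_⟩
      · rw [dist_comm]; linarith [hn.1]
      · rw [dist_comm]; linarith [hn.2.1]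
      · rw [dist_self_add_right, norm_smul, Real.norm_eq_abs, abs_of_pos hθ.1, ← dist_eq_norm]
        have := hn.2.2.1
        nlinarith [hθ.2, hθ.1, dist_nonneg (x := κ t) (y := κ s)]
      · rw [dist_comm]; exact hquot)
  simp only [hq, map_smul, smul_eq_mul] at hclose
  rw [hθeq] at hclose
  set Δ := Φ t (X t) (ω + j (κ t)) - Φ t (X t) (ω + j (κ s)) with hΔ
  have e : Δ - D s (X s) (ω + j (κ s)) (κ' s) * (t - s)
      = -((D s (X s) (ω + j (κ s)) (κ' s) - (t - s)⁻¹ * Δ) * (t - s)) := by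
    field_simp
    ring
  simp only
  rw [← hΔ, e, abs_neg, abs_mul, abs_of_pos hts]
  gcongr

/-- Along the curve, `Φ(s, X(s), Γ(s))` inherits the Hölder regularity of `Φ` in `(t, x)`, the
dependence on the path being locally Lipschitz. -/
theorem exists_holderBound_along_curve {H : ℝ} {j : E →L[ℝ] PathSpace T}
    {Φ : ℝ → ℝ → PathSpace T → ℝ} {D : ℝ → ℝ → PathSpace T → (E →L[ℝ] ℝ)}
    (hΦ : IsC1AlongE H j Φ D) {ω : PathSpace T} (hω : ω ∈ holderPaths T H)
    {κ κ' : ℝ → E} (hκ : ∀ t ∈ Set.Icc 0 T, HasDerivWithinAt κ (κ' t) (Set.Icc 0 T) t)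
    (hκ' : ContinuousOn κ' (Set.Icc 0 T)) (hκH : ∀ t ∈ Set.Icc 0 T, j (κ t) ∈ holderPaths T H)
    {X : ℝ → ℝ} {α C CX R : ℝ} (hT : 0 ≤ T) (hα : 0 < α) (hα1 : α ≤ 1) (hC : 0 ≤ C) (hCX : 0 ≤ CX)
    (hX : HolderBound T α CX X) (hXR : ∀ s ∈ Set.Icc 0 T, |X s| ≤ R)
    (hΦx : ∀ r ∈ Set.Icc 0 T, ∀ s ∈ Set.Icc 0 T, ∀ t ∈ Set.Icc 0 T, ∀ x y, |x| ≤ R → |y| ≤ R →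
      |Φ s x (ω + j (κ r)) - Φ t y (ω + j (κ r))| ≤ C * (|s - t| ^ α + |x - y|)) :
    ∃ C', 0 ≤ C' ∧ HolderBound T α C' (fun s => Φ s (X s) (ω + j (κ s))) := by
  obtain ⟨hDc, hN⟩ := negligible_curve_increment hΦ hω hκ hκ' hκH (hX.continuousOn hα)
  obtain ⟨K, hK⟩ := isCompact_Icc.exists_bound_of_continuousOn hDc
  obtain ⟨δ, hδ, h⟩ := hN 1 one_pos
  have hloc : ∀ s t, 0 ≤ s → s ≤ t → t ≤ T → t - s < δ →
      |Φ t (X t) (ω + j (κ t)) - Φ s (X s) (ω + j (κ s))|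
        ≤ ((1 + |K|) * T ^ (1 - α) + C * (1 + CX)) * (t - s) ^ α := by
    intro s t hs hst ht hd
    have hs' : s ∈ Set.Icc 0 T := ⟨hs, hst.trans ht⟩
    have ht' : t ∈ Set.Icc 0 T := ⟨hs.trans hst, ht⟩
    have h0 := sub_nonneg.2 hst
    have a1 := h s t hs hst ht hd
    have a2 := hΦx s hs' t ht' s hs' (X t) (X s) (hXR t ht') (hXR s hs')
    rw [abs_of_nonneg h0] at a2
    have a3 := hX s t hs hst ht
    have a4 : t - s ≤ T ^ (1 - α) * (t - s) ^ α := by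
      have := rpow_le_mul_rpow h0 (by linarith : t - s ≤ T) hα hα1
      rwa [Real.rpow_one] at this
    have a5 : |D s (X s) (ω + j (κ s)) (κ' s) * (t - s)| ≤ |K| * (t - s) := by
      rw [abs_mul, abs_of_nonneg h0]
      exact mul_le_mul_of_nonneg_right ((hK s hs').trans (le_abs_self K)) h0
    have e : Φ t (X t) (ω + j (κ t)) - Φ s (X s) (ω + j (κ s))
        = (Φ t (X t) (ω + j (κ t)) - Φ t (X t) (ω + j (κ s))
          - D s (X s) (ω + j (κ s)) (κ' s) * (t - s))
          + D s (X s) (ω + j (κ s)) (κ' s) * (t - s)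
          + (Φ t (X t) (ω + j (κ s)) - Φ s (X s) (ω + j (κ s))) := by ring
    rw [e]
    calc _ ≤ 1 * (t - s) + |K| * (t - s) + C * ((t - s) ^ α + |X t - X s|) :=
          (abs_add_three _ _ _).trans (add_le_add (add_le_add a1 a5) a2)
      _ ≤ 1 * (T ^ (1 - α) * (t - s) ^ α) + |K| * (T ^ (1 - α) * (t - s) ^ α)
          + C * ((t - s) ^ α + CX * (t - s) ^ α) := by gcongr
      _ = _ := by ring
  exact HolderBound.of_local hα (by positivity) hδ hloc

end Curve

end PathSpace

/-! ### The generalized Itô formula -/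

theorem theorem3p2
    {T H : ℝ} (hT : 0 < T) (hH : 1 / 2 < H) (hH1 : H < 1)
    [MeasurableSpace (PathSpace T)] [BorelSpace (PathSpace T)]
    (P : Measure (PathSpace T)) (hP : PathSpace.IsFBMLaw H P)
    -- the Banach space of directions, continuously embedded in the path space
    {E : Type*} [NormedAddCommGroup E] [NormedSpace ℝ E] [CompleteSpace E]
    (j : E →L[ℝ] PathSpace T) (hj : Function.Injective j)
    -- the data
    (η : ℝ → PathSpace T → ℝ) (ξ : PathSpace T → ℝ)
    (f₀ f₁ : ℝ → ℝ → PathSpace T → ℝ) (g₀ g₁ : ℝ → PathSpace T → ℝ)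
    (h : ℝ → ℝ → PathSpace T → ℝ)
    (hηm : Measurable (fun p : ℝ × PathSpace T => η p.1 p.2)) (hξm : Measurable ξ)
    (hf₀m : Measurable (fun p : ℝ × ℝ × PathSpace T => f₀ p.1 p.2.1 p.2.2))
    (hf₁m : Measurable (fun p : ℝ × ℝ × PathSpace T => f₁ p.1 p.2.1 p.2.2))
    (hg₀m : Measurable (fun p : ℝ × PathSpace T => g₀ p.1 p.2))
    (hg₁m : Measurable (fun p : ℝ × PathSpace T => g₁ p.1 p.2))
    -- the transformation `Γ`, starting at the identity, differentiable in time in `E`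
    (hh : ∀ ω ∈ PathSpace.holderPaths T H,
      ContinuousOn (fun p : ℝ × ℝ => h p.1 p.2 ω) (Set.Icc 0 T ×ˢ Set.Icc 0 T))
    (hΓ0 : ∀ ω ∈ PathSpace.holderPaths T H, PathSpace.transform h 0 ω = ω)
    (dΓ : ℝ → PathSpace T → E)
    (hdΓ : ∀ ω ∈ PathSpace.holderPaths T H,
      PathSpace.IsC1CurveInE j (fun t => PathSpace.transform h t ω) (fun t => dΓ t ω))
    -- regularity of the coefficients
    (hf₀ : ∀ ω ∈ PathSpace.holderPaths T H,
      ContinuousOn (fun p : ℝ × ℝ × ℝ => f₀ p.1 p.2.1 (PathSpace.transform h p.2.2 ω))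
        (Set.Icc 0 T ×ˢ Set.univ ×ˢ Set.Icc 0 T))
    (hf₁ : ∀ ω ∈ PathSpace.holderPaths T H,
      PathSpace.IsHolderLipJointlyAlong (1 - H) (fun r => PathSpace.transform h r ω) f₁)
    (hg₀ : ∀ ω ∈ PathSpace.holderPaths T H, ContinuousOn (fun s => g₀ s ω) (Set.Icc 0 T))
    (hg₁ : ∀ ω ∈ PathSpace.holderPaths T H, ∃ μ > 1 - H, ∃ C : ℝ,
      ∀ s ∈ Set.Icc (0 : ℝ) T, ∀ t ∈ Set.Icc (0 : ℝ) T, |g₁ s ω - g₁ t ω| ≤ C * |s - t| ^ μ)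
    -- regularity of `F` and of `∂F/∂x`
    (F : ℝ → ℝ → PathSpace T → ℝ) (hF : F = PathSpace.fieldF η f₀ f₁)
    (G : ℝ → PathSpace T → ℝ) (hG : G = PathSpace.processG ξ g₀ g₁)
    (hFx : ∀ ω ∈ PathSpace.holderPaths T H, ∀ t ∈ Set.Icc (0 : ℝ) T, ∀ x : ℝ,
      DifferentiableAt ℝ (fun y => F t y ω) x)
    (hFreg : ∀ ω ∈ PathSpace.holderPaths T H,
      PathSpace.IsHolderLipAlong (1 - H) (fun r => PathSpace.transform h r ω) F)
    (hFxreg : ∀ ω ∈ PathSpace.holderPaths T H,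
      PathSpace.IsHolderLipAlong (1 - H) (fun r => PathSpace.transform h r ω)
        (PathSpace.partialX F))
    (DF DFx : ℝ → ℝ → PathSpace T → (E →L[ℝ] ℝ))
    (hDF : PathSpace.IsC1AlongE H j F DF)
    (hDFx : PathSpace.IsC1AlongE H j (PathSpace.partialX F) DFx) :
    (∀ᵐ ω ∂P, ω ∈ PathSpace.holderPaths T H) ∧
    ∀ ω ∈ PathSpace.holderPaths T H, ∀ t ∈ Set.Icc (0 : ℝ) T,
      let Γ : ℝ → PathSpace T := fun s => PathSpace.transform h s ω
      IntervalIntegrable (fun s => f₀ s (G s ω) (Γ s)) volume 0 t ∧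
      PathSpace.PathwiseIntegrable (fun s => f₁ s (G s ω) (Γ s)) ω t ∧
      IntervalIntegrable (fun s => f₁ s (G s ω) (Γ s) * h s s ω) volume 0 t ∧
      IntervalIntegrable (fun s => PathSpace.partialX F s (G s ω) (Γ s) * g₀ s ω) volume 0 t ∧
      PathSpace.PathwiseIntegrable
        (fun s => PathSpace.partialX F s (G s ω) (Γ s) * g₁ s ω) ω t ∧
      IntervalIntegrable (fun s => DF s (G s ω) (Γ s) (dΓ s ω)) volume 0 t ∧
      F t (G t ω) (Γ t) =
        η (ξ ω) ω + (∫ s in (0 : ℝ)..t, f₀ s (G s ω) (Γ s))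
          + PathSpace.pathwiseIntegral (fun s => f₁ s (G s ω) (Γ s)) ω t
          + (∫ s in (0 : ℝ)..t, f₁ s (G s ω) (Γ s) * h s s ω)
          + (∫ s in (0 : ℝ)..t, PathSpace.partialX F s (G s ω) (Γ s) * g₀ s ω)
          + PathSpace.pathwiseIntegral
              (fun s => PathSpace.partialX F s (G s ω) (Γ s) * g₁ s ω) ω t
          + (∫ s in (0 : ℝ)..t, DF s (G s ω) (Γ s) (dΓ s ω)) := by
  refine ⟨hP.ae_mem_holderPaths hT (by linarith), fun ω hω t ht => ?_⟩
  intro Γ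
  obtain ⟨μ₁, hμ₁, hf₁'⟩ := hf₁ ω hω
  obtain ⟨μ₂, hμ₂, Cg, hg₁'⟩ := hg₁ ω hω
  obtain ⟨μ₃, hμ₃, hFx'⟩ := hFxreg ω hω
  obtain ⟨κ, hκγ, hκd, hκ'⟩ := hdΓ ω hω
  have hh' := hh ω hω
  have hf₀' := hf₀ ω hω
  have hg₀' := hg₀ ω hω
  -- one exponent `α` for all integrands; `α ≤ 1 / 2` ensures `α ≤ β` below
  obtain ⟨α, hα, hα2, hαμ₁, hαμ₂, hαμ₃⟩ :
      ∃ α, 1 - H < α ∧ α ≤ 1 / 2 ∧ α ≤ μ₁ ∧ α ≤ μ₂ ∧ α ≤ μ₃ :=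
    ⟨min (1 / 2) (min μ₁ (min μ₂ μ₃)),
      lt_min (by linarith) (lt_min hμ₁ (lt_min hμ₂ hμ₃)), min_le_left _ _,
      (min_le_right _ _).trans (min_le_left _ _),
      (min_le_right _ _).trans ((min_le_right _ _).trans (min_le_left _ _)),
      (min_le_right _ _).trans ((min_le_right _ _).trans (min_le_right _ _))⟩
  obtain ⟨β, hβα, hβH⟩ := exists_between (show 1 - α < H by linarith)
  have hα0 : 0 < α := by linarith
  have hβ0 : 0 < β := by linarith
  have hαβ : α ≤ β := by linarith
  have hθ : 1 < α + β := by linarith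
  obtain ⟨Cw, hCw, hw⟩ := PathSpace.exists_holderBound_coord hω hβ0 hβH
  have h0T : (0 : ℝ) ∈ Set.Icc 0 T := ⟨le_rfl, hT.le⟩
  -- the curve `Γ` in terms of `κ`
  have hΓκ : ∀ s ∈ Set.Icc 0 T, Γ s = ω + j (κ s) := fun s hs => by
    have := hκγ s hs
    simp only [hΓ0 ω hω] at this
    exact this
  have hκH : ∀ s ∈ Set.Icc 0 T, j (κ s) ∈ PathSpace.holderPaths T H := fun s hs => by
    have e : j (κ s) = PathSpace.primitivePath T (fun u => h s u ω) :=
      add_left_cancel ((hΓκ s hs).symm.trans rfl)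
    rw [e]
    exact PathSpace.primitivePath_mem_holderPaths hH1.le
      (hh'.comp (f := fun u => (s, u)) (by fun_prop) fun u hu => ⟨hs, hu⟩)
  have hΓH : ∀ s ∈ Set.Icc 0 T, Γ s ∈ PathSpace.holderPaths T H := fun s hs => by
    rw [hΓκ s hs]
    exact PathSpace.add_mem_holderPaths hω (hκH s hs)
  -- the process `G` at the path `ω`
  have hg₁h : PathSpace.HolderBound T α (|Cg| * T ^ (μ₂ - α)) (fun s => g₁ s ω) := by
    refine PathSpace.HolderBound.mono_exponent hα0 hαμ₂ (abs_nonneg _) fun s t hs hst ht => ?_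
    have := hg₁' t ⟨hs.trans hst, ht⟩ s ⟨hs, hst.trans ht⟩
    have h0 := sub_nonneg.2 hst
    rw [abs_of_nonneg h0] at this
    refine this.trans ?_
    gcongr
    exact le_abs_self Cg
  have hYg := PathSpace.young_pathwiseIntegral hT.le hα0 hβ0 hθ (by positivity) hCw hg₁h hw
  obtain ⟨CX, hCX, hX⟩ : ∃ CX, 0 ≤ CX ∧ PathSpace.HolderBound T β CX (fun s => G s ω) := by
    obtain ⟨K, hK⟩ := isCompact_Icc.exists_bound_of_continuousOn hg₀'
    obtain ⟨C, hC, hJ⟩ := PathSpace.holderBound_pathwiseIntegral hT.le hα0 hβ0 hθ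
      (by positivity) hCw hg₁h hw
    have hI := (PathSpace.holderBound_integral hg₀' (K := |K|) fun u hu =>
      (hK u hu).trans (le_abs_self K)).mono_exponent hβ0 (by linarith : β ≤ 1) (abs_nonneg K)
    refine ⟨|K| * T ^ (1 - β) + C, by positivity, fun s t hs hst ht => ?_⟩
    have := (hI.add hJ) s t hs hst ht
    simp only [hG, PathSpace.processG]
    refine le_trans (le_of_eq ?_) this
    congr 1
    ring
  have hXc := hX.continuousOn hβ0
  have NX : PathSpace.Negligible T (fun s t => G t ω - G s ω
      - (g₀ s ω * (t - s) + g₁ s ω * (PathSpace.coord ω t - PathSpace.coord ω s))) :=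
    ((PathSpace.negligible_integral_sub hg₀').add
      (PathSpace.Negligible.of_le_rpow hθ hYg.2)).congr fun s t _ _ _ => by
        simp only [hG, PathSpace.processG]
        ring
  obtain ⟨R, hR⟩ := isCompact_Icc.exists_bound_of_continuousOn hXc
  have hXR : ∀ s ∈ Set.Icc 0 T, |G s ω| ≤ R := hR
  -- regularity of `f₁` and of `∂F/∂x`, with the exponent `α`
  have hlow : ∀ {μ : ℝ}, α ≤ μ → ∀ {s t : ℝ}, s ∈ Set.Icc 0 T → t ∈ Set.Icc 0 T →
      |s - t| ^ μ ≤ T ^ (μ - α) * |s - t| ^ α := fun hμ s t hs ht =>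
    PathSpace.rpow_le_mul_rpow (abs_nonneg _)
      (abs_sub_le_iff.2 ⟨by linarith [hs.2, ht.1], by linarith [ht.2, hs.1]⟩) hα0 hμ
  obtain ⟨C₁, hC₁, hf₁R⟩ : ∃ C, 0 ≤ C ∧ ∀ q ∈ Set.Icc 0 T, ∀ r ∈ Set.Icc 0 T,
      ∀ s ∈ Set.Icc 0 T, ∀ t ∈ Set.Icc 0 T, ∀ x y, |x| ≤ R → |y| ≤ R →
        |f₁ s x (Γ q) - f₁ t y (Γ r)| ≤ C * (|s - t| ^ α + |x - y| + |q - r| ^ α) := by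
    obtain ⟨C, hC⟩ := hf₁' R
    refine ⟨|C| * (T ^ (μ₁ - α) + 1), by positivity, fun q hq r hr s hs t ht x y hx hy => ?_⟩
    have hTμ : 0 ≤ T ^ (μ₁ - α) := by positivity
    calc |f₁ s x (Γ q) - f₁ t y (Γ r)| ≤ C * (|s - t| ^ μ₁ + |x - y| + |q - r| ^ μ₁) :=
          hC q hq r hr s hs t ht x y hx hy
      _ ≤ |C| * ((T ^ (μ₁ - α) + 1) * |s - t| ^ α + (T ^ (μ₁ - α) + 1) * |x - y|
            + (T ^ (μ₁ - α) + 1) * |q - r| ^ α) := by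
          gcongr
          · exact le_abs_self C
          · exact (hlow hαμ₁ hs ht).trans (by gcongr; linarith)
          · exact le_mul_of_one_le_left (abs_nonneg _) (by linarith)
          · exact (hlow hαμ₁ hq hr).trans (by gcongr; linarith)
      _ = _ := by ring
  obtain ⟨C₂, hC₂, hFxR⟩ : ∃ C, 0 ≤ C ∧ ∀ r ∈ Set.Icc 0 T,
      ∀ s ∈ Set.Icc 0 T, ∀ t ∈ Set.Icc 0 T, ∀ x y, |x| ≤ R → |y| ≤ R →
        |PathSpace.partialX F s x (Γ r) - PathSpace.partialX F t y (Γ r)|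
          ≤ C * (|s - t| ^ α + |x - y|) := by
    obtain ⟨C, hC⟩ := hFx' R
    refine ⟨|C| * (T ^ (μ₃ - α) + 1), by positivity, fun r hr s hs t ht x y hx hy => ?_⟩
    have hTμ : 0 ≤ T ^ (μ₃ - α) := by positivity
    calc |PathSpace.partialX F s x (Γ r) - PathSpace.partialX F t y (Γ r)|
        ≤ C * (|s - t| ^ μ₃ + |x - y|) := hC r hr s hs t ht x y hx hy
      _ ≤ |C| * ((T ^ (μ₃ - α) + 1) * |s - t| ^ α + (T ^ (μ₃ - α) + 1) * |x - y|) := by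
          gcongr
          · exact le_abs_self C
          · exact (hlow hαμ₃ hs ht).trans (by gcongr; linarith)
          · exact le_mul_of_one_le_left (abs_nonneg _) (by linarith)
      _ = _ := by ring
  -- the integrands of the two pathwise integrals are `α`-Hölder
  have hXα := hX.mono_exponent hα0 hαβ hCX
  have hCXα : 0 ≤ CX * T ^ (β - α) := by positivity
  have hb₁ : PathSpace.HolderBound T α (C₁ * (1 + CX * T ^ (β - α) + 1))
      (fun s => f₁ s (G s ω) (Γ s)) := by
    intro s t hs hst ht
    have hs' : s ∈ Set.Icc 0 T := ⟨hs, hst.trans ht⟩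
    have ht' : t ∈ Set.Icc 0 T := ⟨hs.trans hst, ht⟩
    have h1 := hf₁R t ht' s hs' t ht' s hs' _ _ (hXR t ht') (hXR s hs')
    have h2 := hXα s t hs hst ht
    rw [abs_of_nonneg (sub_nonneg.2 hst)] at h1
    refine h1.trans ?_
    rw [mul_assoc]
    refine mul_le_mul_of_nonneg_left ?_ hC₁
    linarith
  obtain ⟨C₃, hC₃, hFxh⟩ : ∃ C, 0 ≤ C ∧ PathSpace.HolderBound T α C
      (fun s => PathSpace.partialX F s (G s ω) (Γ s)) := by
    obtain ⟨C, hC, hb⟩ := PathSpace.exists_holderBound_along_curve hDFx hω hκd hκ' hκH hT.le hα0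
      (by linarith) hC₂ hCXα hXα hXR fun r hr => by
        rw [← hΓκ r hr]
        exact hFxR r hr
    refine ⟨C, hC, fun s t hs hst ht => ?_⟩
    have := hb s t hs hst ht
    simp only at this ⊢
    rwa [← hΓκ s ⟨hs, hst.trans ht⟩, ← hΓκ t ⟨hs.trans hst, ht⟩] at this
  have hb₁c := hb₁.continuousOn hα0
  have hFxc := hFxh.continuousOn hα0
  have hg₁c := hg₁h.continuousOn hα0
  obtain ⟨K₁, hK₁⟩ := isCompact_Icc.exists_bound_of_continuousOn hFxc
  obtain ⟨K₂, hK₂⟩ := isCompact_Icc.exists_bound_of_continuousOn hg₁c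
  have hK₁0 : 0 ≤ K₁ := (norm_nonneg _).trans (hK₁ 0 h0T)
  have hK₂0 : 0 ≤ K₂ := (norm_nonneg _).trans (hK₂ 0 h0T)
  have hb₂ := PathSpace.HolderBound.mul hK₁ hK₂ hFxh hg₁h
  have hY₁ := PathSpace.young_pathwiseIntegral hT.le hα0 hβ0 hθ (by positivity) hCw hb₁ hw
  have hY₂ := PathSpace.young_pathwiseIntegral hT.le hα0 hβ0 hθ (by positivity) hCw hb₂ hw
  -- continuity of the integrands of the Lebesgue integrals
  have hA₁ : ContinuousOn (fun s => f₀ s (G s ω) (Γ s)) (Set.Icc 0 T) :=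
    hf₀'.comp (f := fun s => (s, G s ω, s)) (continuousOn_id.prodMk (hXc.prodMk continuousOn_id))
      fun s hs => ⟨hs, trivial, hs⟩
  have hA₂ : ContinuousOn (fun s => f₁ s (G s ω) (Γ s) * h s s ω) (Set.Icc 0 T) :=
    hb₁c.mul (hh'.comp (f := fun s => (s, s)) (by fun_prop) fun s hs => ⟨hs, hs⟩)
  have hA₃ : ContinuousOn (fun s => PathSpace.partialX F s (G s ω) (Γ s) * g₀ s ω)
      (Set.Icc 0 T) := hFxc.mul hg₀'
  obtain ⟨hA₄', NC⟩ := PathSpace.negligible_curve_increment hDF hω hκd hκ' hκH hXc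
  have hA₄ : ContinuousOn (fun s => DF s (G s ω) (Γ s) (dΓ s ω)) (Set.Icc 0 T) :=
    hA₄'.congr fun s hs => by simp only [hΓκ s hs]
  -- the three parts of the increment of `F(s, G(s), Γ(s))`
  have NA := PathSpace.negligible_fieldF_time (η := η) hT.le hα0 hβ0 (by linarith) hθ hCw hw hh'
    hXc hXR hf₀' hC₁ (fun r hr x hx s t hs hst ht => by
      have := hf₁R r hr r hr t ⟨hs.trans hst, ht⟩ s ⟨hs, hst.trans ht⟩ x x hx hx
      simpa [Real.zero_rpow hα0.ne', abs_of_nonneg (sub_nonneg.2 hst)] using this) hb₁c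
  have NB := PathSpace.negligible_space_increment (Φ := F) (γ := Γ) hα0 hαβ hθ hC₂ hCX hX hXR
    (fun r hr t ht x => hFx _ (hΓH r hr) t ht x) hFxR
  have NBX := NX.bdd_mul (b := fun s => PathSpace.partialX F s (G s ω) (Γ s))
    fun s hs hsT => hK₁ s ⟨hs, hsT⟩
  have I₁ := PathSpace.negligible_integral_sub hA₁
  have I₂ := PathSpace.negligible_integral_sub hA₂
  have I₃ := PathSpace.negligible_integral_sub hA₃
  have I₄ := PathSpace.negligible_integral_sub hA₄
  have J₁ := PathSpace.Negligible.of_le_rpow hθ hY₁.2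
  have J₂ := PathSpace.Negligible.of_le_rpow hθ hY₂.2
  have key : PathSpace.Negligible T (fun s t =>
      (fun t => F t (G t ω) (Γ t) - ((∫ s in (0 : ℝ)..t, f₀ s (G s ω) (Γ s))
          + PathSpace.pathwiseIntegral (fun s => f₁ s (G s ω) (Γ s)) ω t
          + (∫ s in (0 : ℝ)..t, f₁ s (G s ω) (Γ s) * h s s ω)
          + (∫ s in (0 : ℝ)..t, PathSpace.partialX F s (G s ω) (Γ s) * g₀ s ω)
          + PathSpace.pathwiseIntegral
              (fun s => PathSpace.partialX F s (G s ω) (Γ s) * g₁ s ω) ω t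
          + (∫ s in (0 : ℝ)..t, DF s (G s ω) (Γ s) (dΓ s ω)))) t
      - (fun t => F t (G t ω) (Γ t) - ((∫ s in (0 : ℝ)..t, f₀ s (G s ω) (Γ s))
          + PathSpace.pathwiseIntegral (fun s => f₁ s (G s ω) (Γ s)) ω t
          + (∫ s in (0 : ℝ)..t, f₁ s (G s ω) (Γ s) * h s s ω)
          + (∫ s in (0 : ℝ)..t, PathSpace.partialX F s (G s ω) (Γ s) * g₀ s ω)
          + PathSpace.pathwiseIntegral
              (fun s => PathSpace.partialX F s (G s ω) (Γ s) * g₁ s ω) ω t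
          + (∫ s in (0 : ℝ)..t, DF s (G s ω) (Γ s) (dΓ s ω)))) s) := by
    refine ((((NA.add NB).add NBX).add NC).sub
      (((((I₁.add J₁).add I₂).add I₃).add J₂).add I₄)).congr fun s t hs hst ht => ?_
    rw [← hΓκ s ⟨hs, hst.trans ht⟩, ← hΓκ t ⟨hs.trans hst, ht⟩, ← hF]
    ring
  have hmain := key.eq_zero_of_increment ht
  have hinit : F 0 (G 0 ω) (Γ 0) = η (ξ ω) ω := by
    simp only [Γ, hΓ0 ω hω, hF, hG, PathSpace.fieldF, PathSpace.processG,
      PathSpace.pathwiseIntegral_zero, intervalIntegral.integral_same, add_zero]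
  simp only [intervalIntegral.integral_same, PathSpace.pathwiseIntegral_zero, hinit, add_zero,
    sub_zero] at hmain
  have hint : ∀ {v : ℝ → ℝ}, ContinuousOn v (Set.Icc 0 T) → IntervalIntegrable v volume 0 t :=
    fun hv => PathSpace.intervalIntegrable_of_continuousOn_Icc hv h0T ht
  refine ⟨hint hA₁, hY₁.1 t ht, hint hA₂, hint hA₃, hY₂.1 t ht, hint hA₄, ?_⟩
  linarith
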